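/- \textbf{Theorem (Mesh-induced error).} Let $\Omega=[a,b]$ with $a<b$, $|\Omega|=b-a$, $T>0$, $\lambda>0$, and let $N,L\ge 1$ be integers. Let $x_n=a+n\Delta x$, $t_l=l\Delta t$ ($1\le n\le N$, $1\le l\le L$), where $\Delta x=(b-a)/N$ and $\Delta t=T/L$. Let $K_1,K_2:\mathbb R\times\mathbb R\to\mathbb R$ be Mercer kernels (continuous, symmetric, positive semidefinite) with reproducing kernel Hilbert spaces $\mathcal H_{K_1},\mathcal H_{K_2}$. Assume that $K_1$ is $C^6$ on $\Omega\times\Omega$ and $K_2$ is $C^6$ on $D\times D$, where $D=\Omega-\Omega=[a-b,b-a]$. Put $\|(\phi,\psi)\|^2=\|\phi\|_{\mathcal H_{K_1}}^2+\|\psi\|_{\mathcal H_{K_2}}^2$ on $\mathcal H_{K_1}\times\mathcal H_{K_2}$. Let $\rho\in C^{1,2}([0,T]\times\Omega)$, i.e. all derivatives $\partial_t^i\partial_x^j\rho$ with $i\le 1$, $j\le 2$ (mixed ones included) exist and are continuous on $[0,T]\times\Omega$, and let every $\rho_t=\rho(t,\cdot)$ be a probability density on $\Omega$. For $\phi\in\mathcal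 H_{K_1}$, $\psi\in\mathcal H_{K_2}$ put $$A(\phi,\psi)(t,x)=\partial_x\Big(\rho_t\,\partial_x\big(\phi+\psi*\rho_t\big)\Big)(x),\qquad (\psi*\rho_t)(x)=\int_\Omega\psi(x-y)\rho_t(y)\,dy .$$ Let $L^2$ be taken on $[0,T]\times\Omega$ with respect to $\rho_t(x)\,dx\,dt$. Let $(V,W)\in\mathcal H_{K_1}\times\mathcal H_{K_2}$, and let $f$ be the exact data of a flow driven by $(V,W)$, that is, $f=A(V,W)$ on $[0,T]\times\Omega$. (For the Wasserstein gradient flow $f=\partial_t\rho-\partial_x(\rho\,\partial_xU'(\rho))$; for the Wasserstein Hamiltonian flow $f=\partial_{tt}\rho+\Gamma_W(\partial_t\rho,\partial_t\rho)-\partial_x(\rho\,\partial_xU'(\rho))$, with $U$ the internal energy and $\Gamma_W$ the Christoffel symbol of Otto's metric; the equation of either flow is $f=A(V,W)$.) Consider $$R_\lambda(\phi,\psi)=\|A(\phi,\psi)-A(V,W)\|_{L^2}^2+\lambda\|(\phi,\psi)\|^2,$$ $$R_{\lambda,NL}(\phi,\psi)=\frac{T|\Omega|}{NL}\sum_{n=1}^{N}\sum_{l=1}^{L}\big|A(\phi,\psi)(t_l,x_n)-f(t_l,x_n)\big|^2\rho_{t_l}(x_n)+\lambda\|(\phi,\psi)\|^2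 .$$ Then $A$ maps $\mathcal H_{K_1}\times\mathcal H_{K_2}$ into $L^2$; $R_\lambda$ and $R_{\lambda,NL}$ have unique minimizers $(V_\lambda^*,W_\lambda^*)$ and $(V_{\lambda,NL},W_{\lambda,NL})$; with $B=A^*A$, a bounded operator on $\mathcal H_{K_1}\times\mathcal H_{K_2}$, the operator $B+\lambda$ is invertible and $(V_\lambda^*,W_\lambda^*)=(B+\lambda)^{-1}B(V,W)$; and $$\|(V_{\lambda,NL},W_{\lambda,NL})-(V_\lambda^*,W_\lambda^*)\|\le\Big(\sqrt{\tfrac{2TC_T}{\lambda}}(\kappa_1+\kappa_2)+1\Big)\,C_1\,\lambda^{-1}\,\|(V,W)\|\,(\Delta x+\Delta t)^{1/2}.$$ Here $$C_1=2T|\Omega|(\kappa_1+\kappa_2)^2\big(4+|\Omega|\,\|\partial_t\rho\|_\infty\big)\|\rho\|_{C^{1,2}}^3,\qquad C_T=\sup_{t\in[0,T]}\|\rho_t\|_{C^1(\Omega)},$$ $\kappa_1=\sqrt{2\|K_1\|_{C^6(\Omega\times\Omega)}}$ and $\kappa_2=\sqrt{2\|K_2\|_{C^6(D\times D)}}$.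 Every $C^m$ or $C^{m,n}$ norm is the maximum of the sup norms of the derivatives involved: those of total order at most $m$ for $C^m$, and $\partial_t^i\partial_x^j\rho$ with $i\le m$, $j\le n$ for $C^{m,n}$. -/

import Mathlib

open MeasureTheory
open scoped InnerProductSpace

noncomputable section

namespace FlowLearning

/-! ### Kernels -/

/-- A Mercer kernel on the real line: continuous, symmetric and positive semidefinite. -/
structure IsMercerKernel (K : ℝ → ℝ → ℝ) : Prop where
  continuous : Continuous (Function.uncurry K)
  posSemidef : (Matrix.of K).PosSemidef

/-- `∂ₓⁱ ∂ᵧʲ K (x, y)`, with one-sided derivatives at the end points of the interval `D`. -/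
def kernelPartial (D : Set ℝ) (i j : ℕ) (K : ℝ → ℝ → ℝ) (x y : ℝ) : ℝ :=
  iteratedDerivWithin i (fun x' => iteratedDerivWithin j (K x') D y) D x

/-- The norm `‖K‖_{C^m(D × D)}`: the largest supremum over `D × D` of a partial derivative of
total order at most `m`. -/
def kernelNorm (D : Set ℝ) (m : ℕ) (K : ℝ → ℝ → ℝ) : ℝ :=
  sSup {r | ∃ i j : ℕ, i + j ≤ m ∧ ∃ x ∈ D, ∃ y ∈ D, r = |kernelPartial D i j K x y|}

/-- `κ = √(2 ‖K‖_{C⁶(D × D)})`. -/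
def kappa (D : Set ℝ) (K : ℝ → ℝ → ℝ) : ℝ := √(2 * kernelNorm D 6 K)

/-! ### Density flows on `[0, T] × [a, b]`, written `ρ t x` -/

/-- `∂ₜⁱ ∂ₓʲ ρ (t, x)`, with one-sided derivatives at the end points. -/
def flowPartial (T a b : ℝ) (i j : ℕ) (ρ : ℝ → ℝ → ℝ) (t x : ℝ) : ℝ :=
  iteratedDerivWithin i (fun s => iteratedDerivWithin j (ρ s) (Set.Icc a b) x) (Set.Icc 0 T) t

/-- `ρ ∈ C^{m,n}([0, T] × [a, b])`: all derivatives `∂ₜⁱ ∂ₓʲ ρ` with `i ≤ m` and `j ≤ n`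
exist and are continuous on `[0, T] × [a, b]`. -/
structure IsFlowOfClass (m n : ℕ) (T a b : ℝ) (ρ : ℝ → ℝ → ℝ) : Prop where
  contDiffOn_space : ∀ t ∈ Set.Icc 0 T, ContDiffOn ℝ n (ρ t) (Set.Icc a b)
  contDiffOn_time : ∀ j ≤ n, ∀ x ∈ Set.Icc a b,
    ContDiffOn ℝ m (fun t => iteratedDerivWithin j (ρ t) (Set.Icc a b) x) (Set.Icc 0 T)
  continuousOn_partial : ∀ i ≤ m, ∀ j ≤ n,
    ContinuousOn (Function.uncurry (flowPartial T a b i j ρ)) (Set.Icc 0 T ×ˢ Set.Icc a b)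

/-- The norm `‖ρ‖_{C^{m,n}}`: the largest supremum over `[0, T] × [a, b]` of a derivative
`∂ₜⁱ ∂ₓʲ ρ` with `i ≤ m` and `j ≤ n`. -/
def flowNorm (m n : ℕ) (T a b : ℝ) (ρ : ℝ → ℝ → ℝ) : ℝ :=
  sSup {r | ∃ i ≤ m, ∃ j ≤ n, ∃ t ∈ Set.Icc 0 T, ∃ x ∈ Set.Icc a b,
    r = |flowPartial T a b i j ρ t x|}

/-- `‖∂ₜ ρ‖_∞` over `[0, T] × [a, b]`. -/
def timeDerivNorm (T a b : ℝ) (ρ : ℝ → ℝ → ℝ) : ℝ :=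
  sSup {r | ∃ t ∈ Set.Icc 0 T, ∃ x ∈ Set.Icc a b, r = |flowPartial T a b 1 0 ρ t x|}

/-- Every `ρ t` is a probability density on `[a, b]`. -/
def IsProbabilityFlow (T a b : ℝ) (ρ : ℝ → ℝ → ℝ) : Prop :=
  ∀ t ∈ Set.Icc 0 T, (∀ x ∈ Set.Icc a b, 0 ≤ ρ t x) ∧ ∫ x in a..b, ρ t x = 1

/-- `C_T = sup_t ‖ρ_t‖_{C¹}`, the supremum over time of the `C¹([a, b])` norm. -/
def supC1Norm (T a b : ℝ) (ρ : ℝ → ℝ → ℝ) : ℝ := flowNorm 0 1 T a b ρ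

/-! ### The operator `A` -/

/-- `(ψ * r)(x) = ∫ ψ (x - y) r y dy` for a density `r` carried by `[a, b]`. -/
def conv (a b : ℝ) (ψ r : ℝ → ℝ) (x : ℝ) : ℝ := ∫ y in a..b, ψ (x - y) * r y

/-- The weighted Laplacian `Δ_r g = ∂ₓ (r ∂ₓ g)` on `[a, b]`. -/
def weightedLaplacian (a b : ℝ) (r g : ℝ → ℝ) (x : ℝ) : ℝ :=
  derivWithin (fun y => r y * derivWithin g (Set.Icc a b) y) (Set.Icc a b) x

/-- `A(φ, ψ)(t, x) = Δ_{ρ_t} (φ + ψ * ρ_t)(x)`. -/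
def flowOperator (a b : ℝ) (ρ : ℝ → ℝ → ℝ) (φ ψ : ℝ → ℝ) (t x : ℝ) : ℝ :=
  weightedLaplacian a b (ρ t) (fun y => φ y + conv a b ψ (ρ t) y) x

/-! ### The two minimization problems

`WithLp 2 (H₁ × H₂)` is the Hilbert space `H₁ × H₂` with `‖(φ, ψ)‖² = ‖φ‖² + ‖ψ‖²`. -/

section Loss

variable {H₁ H₂ : Type*} [NormedAddCommGroup H₁] [InnerProductSpace ℝ H₁] [RKHS ℝ H₁ ℝ ℝ]
  [NormedAddCommGroup H₂] [InnerProductSpace ℝ H₂] [RKHS ℝ H₂ ℝ ℝ]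

/-- The inner product of `A p` and `A q` in `L²([0, T] × [a, b], ρ_t(x) dx dt)`. -/
def flowInner (T a b : ℝ) (ρ : ℝ → ℝ → ℝ) (p q : WithLp 2 (H₁ × H₂)) : ℝ :=
  ∫ t in (0 : ℝ)..T, ∫ x in a..b,
    flowOperator a b ρ p.fst p.snd t x * flowOperator a b ρ q.fst q.snd t x * ρ t x

/-- The regularized expected loss
`‖A p - A (V, W)‖²_{L²} + lam ‖φ‖² + lam ‖ψ‖²` at `p = (φ, ψ)`. -/
def expectedLoss (T a b lam : ℝ) (ρ : ℝ → ℝ → ℝ) (V : H₁) (W : H₂)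
    (p : WithLp 2 (H₁ × H₂)) : ℝ :=
  (∫ t in (0 : ℝ)..T, ∫ x in a..b,
    (flowOperator a b ρ p.fst p.snd t x - flowOperator a b ρ V W t x) ^ 2 * ρ t x)
  + lam * ‖p.fst‖ ^ 2 + lam * ‖p.snd‖ ^ 2

/-- The sampled loss on the mesh `t_l = l T / L`, `x_n = a + n (b - a) / N`,
`1 ≤ l ≤ L`, `1 ≤ n ≤ N`, with exact derivatives and data `f`. -/
def sampledLoss (T a b lam : ℝ) (N L : ℕ) (ρ f : ℝ → ℝ → ℝ) (p : WithLp 2 (H₁ × H₂)) : ℝ :=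
  T * (b - a) / (N * L) * (∑ n ∈ Finset.Icc 1 N, ∑ l ∈ Finset.Icc 1 L,
    (flowOperator a b ρ p.fst p.snd (l * (T / L)) (a + n * ((b - a) / N))
      - f (l * (T / L)) (a + n * ((b - a) / N))) ^ 2
    * ρ (l * (T / L)) (a + n * ((b - a) / N)))
  + lam * ‖p.fst‖ ^ 2 + lam * ‖p.snd‖ ^ 2

end Loss

/-- `p` is the unique minimizer of `R`. -/
def IsUniqueMinimizer {E : Type*} (R : E → ℝ) (p : E) : Prop := ∀ q, q ≠ p → R p < R q

/-- `C₁ = 2 T |Ω| (κ₁ + κ₂)² (4 + |Ω| ‖∂ₜ ρ‖_∞) ‖ρ‖³_{C^{1,2}}` with `Ω = [a, b]`. -/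
def meshConstant (T a b κ₁ κ₂ : ℝ) (ρ : ℝ → ℝ → ℝ) : ℝ :=
  2 * T * (b - a) * (κ₁ + κ₂) ^ 2 * (4 + (b - a) * timeDerivNorm T a b ρ)
    * flowNorm 1 2 T a b ρ ^ 3

end FlowLearning

end

open FlowLearning

namespace FlowLearning

open Set Filter Topology

/-! Both minimizers solve normal equations for the same target `p₀ = (V, W)`. Since the data are
exact, the losses are `⟪B (p - p₀), p - p₀⟫ + λ‖p‖²` and `⟪B' (p - p₀), p - p₀⟫ + λ‖p‖²`, where `B`
represents the weighted `L²` form of `A` and `B'` its sum over the mesh. The minimizers are `(B +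
λ)⁻¹ B p₀` and `(B' + λ)⁻¹ B' p₀`. They differ by `(B' + λ)⁻¹ (B' - B) (p₀ - p)`, with `p` the first
of them and `‖p₀ - p‖ ≤ ‖p₀‖`, so a bound `ε` on `B - B'` gives the error `ε λ⁻¹ ‖p₀‖`
(`norm_ringInverse_sub_le`).

It remains to bound `B - B'`, which is the error of a product right-endpoint rule for `A p * A q *
ρ`. For this the integrand needs a sup bound and Lipschitz constants in `x` and `t`, all
proportional to `‖p‖ ‖q‖` (`LipBound`). They come from the kernels: the feature map `x ↦ K(x, ·)` of
a `C⁶` kernel has three derivatives in the Hilbert space, with norms at most `κ / √2`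
(`exists_feature_derivatives`), so every member of the space has three derivatives controlled by its
norm. Convolution with `ρ_t` moves all derivatives onto `ψ`, and `A` becomes an explicit expression
in `ρ`, `∂ₓρ` and these derivatives (`flowOperator_eq`).

The quadrature error is of first order in `h = Δx + Δt`, at most `2 C₁ h`; the crude sup bound gives
`C₁ / 2` for every mesh. Together they yield `C₁ √h` (`le_mul_sqrt_of_le_of_le`). The remaining
factor in the theorem is at least `1`. -/

/-! ### Differentiating a feature map through its kernel -/

section Feature

/-- The first partial derivative, within `D × D`, of a function of two real variables. -/
noncomputable def partialFst (D : Set ℝ) (k : ℝ × ℝ → ℝ) (p : ℝ × ℝ) : ℝ :=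
  fderivWithin ℝ k (D ×ˢ D) p (1, 0)

/-- The second partial derivative, within `D × D`, of a function of two real variables. -/
noncomputable def partialSnd (D : Set ℝ) (k : ℝ × ℝ → ℝ) (p : ℝ × ℝ) : ℝ :=
  fderivWithin ℝ k (D ×ˢ D) p (0, 1)

variable {D : Set ℝ} {k : ℝ × ℝ → ℝ} {x y z : ℝ}

theorem hasDerivWithinAt_partialFst (hk : DifferentiableOn ℝ k (D ×ˢ D)) (hx : x ∈ D)
    (hy : y ∈ D) : HasDerivWithinAt (fun s => k (s, y)) (partialFst D k (x, y)) D x := by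
  have h1 : HasDerivWithinAt (fun s : ℝ => (s, y)) (1, 0) D x :=
    (hasDerivWithinAt_id x D).prodMk (hasDerivWithinAt_const x D y)
  exact ((hk (x, y) ⟨hx, hy⟩).hasFDerivWithinAt).comp_hasDerivWithinAt x h1
    (fun s hs => Set.mk_mem_prod hs hy)

theorem hasDerivWithinAt_partialSnd (hk : DifferentiableOn ℝ k (D ×ˢ D)) (hx : x ∈ D)
    (hy : y ∈ D) : HasDerivWithinAt (fun s => k (x, s)) (partialSnd D k (x, y)) D y := by
  have h1 : HasDerivWithinAt (fun s : ℝ => (x, s)) (0, 1) D y :=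
    (hasDerivWithinAt_const y D x).prodMk (hasDerivWithinAt_id y D)
  exact ((hk (x, y) ⟨hx, hy⟩).hasFDerivWithinAt).comp_hasDerivWithinAt y h1
    (fun s hs => Set.mk_mem_prod hx hs)

theorem contDiffOn_partialFst (hD : UniqueDiffOn ℝ D) {n : ℕ}
    (hk : ContDiffOn ℝ (n + 1 : ℕ) k (D ×ˢ D)) : ContDiffOn ℝ n (partialFst D k) (D ×ˢ D) :=
  (hk.fderivWithin (hD.prod hD) (by norm_cast)).clm_apply contDiffOn_const

theorem contDiffOn_partialSnd (hD : UniqueDiffOn ℝ D) {n : ℕ}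
    (hk : ContDiffOn ℝ (n + 1 : ℕ) k (D ×ˢ D)) : ContDiffOn ℝ n (partialSnd D k) (D ×ˢ D) :=
  (hk.fderivWithin (hD.prod hD) (by norm_cast)).clm_apply contDiffOn_const

theorem differentiableOn_of_contDiffOn_succ {n : ℕ} (hk : ContDiffOn ℝ (n + 1 : ℕ) k (D ×ˢ D)) :
    DifferentiableOn ℝ k (D ×ˢ D) :=
  hk.differentiableOn (by norm_cast)

/-- A mixed second difference is close to the mixed second derivative times the increments. -/
theorem abs_mixed_difference_sub_le {S : Set ℝ} (hS : Convex ℝ S) (hSD : S ⊆ D)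
    (hk : DifferentiableOn ℝ k (D ×ˢ D)) (hk' : DifferentiableOn ℝ (partialSnd D k) (D ×ˢ D))
    {m ε : ℝ}
    (hm : ∀ s ∈ S, ∀ t ∈ S, |partialFst D (partialSnd D k) (s, t) - m| ≤ ε)
    {x' z' : ℝ} (hx : x ∈ S) (hx' : x' ∈ S) (hz : z ∈ S) (hz' : z' ∈ S) :
    |k (x', z') - k (x, z') - (k (x', z) - k (x, z)) - m * ((x' - x) * (z' - z))|
      ≤ ε * (|x' - x| * |z' - z|) := by
  have h1 : ∀ t ∈ S, |(partialSnd D k (x', t) - m * x') - (partialSnd D k (x, t) - m * x)|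
      ≤ ε * |x' - x| := fun t ht => by
    refine hS.norm_image_sub_le_of_norm_hasDerivWithin_le
      (f := fun s => partialSnd D k (s, t) - m * s)
      (f' := fun s => partialFst D (partialSnd D k) (s, t) - m * 1)
      (fun s hs => (((hasDerivWithinAt_partialFst hk' (hSD hs) (hSD ht)).sub
        ((hasDerivWithinAt_id s D).const_mul m))).mono hSD) (fun s hs => ?_) hx hx'
    simpa using hm s hs t ht
  have h2 := hS.norm_image_sub_le_of_norm_hasDerivWithin_le
      (f := fun t => k (x', t) - k (x, t) - m * (x' - x) * t)
      (f' := fun t => partialSnd D k (x', t) - partialSnd D k (x, t) - m * (x' - x) * 1)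
      (fun t ht => (((hasDerivWithinAt_partialSnd hk (hSD hx') (hSD ht)).sub
        (hasDerivWithinAt_partialSnd hk (hSD hx) (hSD ht))).sub
        ((hasDerivWithinAt_id t D).const_mul _)).mono hSD) (C := ε * |x' - x|)
      (fun t ht => by
        have := h1 t ht
        rw [Real.norm_eq_abs]
        convert this using 2
        ring) hz hz'
  rw [Real.norm_eq_abs, Real.norm_eq_abs] at h2
  rw [← mul_assoc ε]
  refine (le_of_eq ?_).trans h2
  congr 1
  ring

variable {H : Type*} [NormedAddCommGroup H] [InnerProductSpace ℝ H]

/-- A feature map with a twice continuously differentiable kernel is differentiable. -/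
theorem exists_hasDerivWithinAt_of_kernel [CompleteSpace H] {c d : ℝ} (hcd : c < d) {n : ℕ}
    (hk : ContDiffOn ℝ (n + 2 : ℕ) k (Icc c d ×ˢ Icc c d)) {F : ℝ → H}
    (hF : ∀ x ∈ Icc c d, ∀ y ∈ Icc c d, ⟪F x, F y⟫_ℝ = k (x, y)) :
    ∃ F' : ℝ → H, (∀ x ∈ Icc c d, HasDerivWithinAt F (F' x) (Icc c d) x) ∧
      ∃ k' : ℝ × ℝ → ℝ, ContDiffOn ℝ n k' (Icc c d ×ˢ Icc c d) ∧
        ∀ x ∈ Icc c d, ∀ y ∈ Icc c d, ⟪F' x, F' y⟫_ℝ = k' (x, y) := by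
  have hU := uniqueDiffOn_Icc hcd
  have hk1 : ContDiffOn ℝ (n + 1 : ℕ) (partialSnd (Icc c d) k) (Icc c d ×ˢ Icc c d) :=
    contDiffOn_partialSnd hU hk
  have hd0 := differentiableOn_of_contDiffOn_succ hk
  have hd1 := differentiableOn_of_contDiffOn_succ hk1
  have hk2 := contDiffOn_partialFst hU hk1
  have key : ∀ x ∈ Icc c d, ∃ v, HasDerivWithinAt F v (Icc c d) x := by
    intro x hx
    have hcont := hk2.continuousOn (x, x) ⟨hx, hx⟩
    set m := partialFst (Icc c d) (partialSnd (Icc c d) k) (x, x) with hm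
    have hne : (𝓝[Icc c d \ {x}] x).NeBot := by
      have := uniqueDiffWithinAt_iff_accPt.1 (hU x hx)
      rwa [accPt_principal_iff_nhdsWithin] at this
    have hC : Cauchy (map (slope F x) (𝓝[Icc c d \ {x}] x)) := by
      rw [Metric.cauchy_iff]
      refine ⟨hne.map _, fun r hr => ?_⟩
      -- Expanding `‖slope y - slope z‖²` produces four inner products, each within `r² / 8` of `m`;
      -- the four copies of `m` cancel and at most `r² / 2 < r²` remains.
      obtain ⟨δ, hδ, hball⟩ := Metric.continuousWithinAt_iff.1 hcont (r ^ 2 / 8) (by positivity)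
      have hS : Icc c d \ {x} ∩ Metric.ball x δ ∈ 𝓝[Icc c d \ {x}] x :=
        inter_mem self_mem_nhdsWithin (mem_nhdsWithin_of_mem_nhds (Metric.ball_mem_nhds x hδ))
      refine ⟨slope F x '' (Icc c d \ {x} ∩ Metric.ball x δ), image_mem_map hS, ?_⟩
      have hin : ∀ y ∈ Icc c d \ {x} ∩ Metric.ball x δ, ∀ z ∈ Icc c d \ {x} ∩ Metric.ball x δ,
          |⟪slope F x y, slope F x z⟫_ℝ - m| ≤ r ^ 2 / 8 := by
        rintro y ⟨⟨hy, hyx⟩, hyb⟩ z ⟨⟨hz, hzx⟩, hzb⟩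
        have h := abs_mixed_difference_sub_le (S := Icc c d ∩ Metric.ball x δ)
          ((convex_Icc c d).inter (convex_ball x δ)) inter_subset_left hd0 hd1
          (fun s hs t ht => (hball (x := (s, t)) ⟨hs.1, ht.1⟩
            (by rw [Prod.dist_eq]; exact max_lt hs.2 ht.2)).le)
          ⟨hx, Metric.mem_ball_self hδ⟩ ⟨hy, hyb⟩ ⟨hx, Metric.mem_ball_self hδ⟩ ⟨hz, hzb⟩
        have hyx' : y - x ≠ 0 := sub_ne_zero.2 hyx
        have hzx' : z - x ≠ 0 := sub_ne_zero.2 hzx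
        have hpos : 0 < |y - x| * |z - x| := by positivity
        have e : ⟪slope F x y, slope F x z⟫_ℝ
            = (k (y, z) - k (x, z) - (k (y, x) - k (x, x))) / ((y - x) * (z - x)) := by
          rw [slope_def_module, slope_def_module, inner_smul_left, inner_smul_right,
            inner_sub_left, inner_sub_right, inner_sub_right, hF y hy z hz, hF y hy x hx,
            hF x hx z hz, hF x hx x hx]
          simp only [conj_trivial]
          field_simp
          ring
        rw [e, show (k (y, z) - k (x, z) - (k (y, x) - k (x, x))) / ((y - x) * (z - x)) - m
          = (k (y, z) - k (x, z) - (k (y, x) - k (x, x)) - m * ((y - x) * (z - x)))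
            / ((y - x) * (z - x)) by field_simp, abs_div, abs_mul, div_le_iff₀ hpos]
        exact h
      rintro _ ⟨y, hy, rfl⟩ _ ⟨z, hz, rfl⟩
      rw [dist_eq_norm]
      refine lt_of_pow_lt_pow_left₀ 2 hr.le ?_
      rw [@norm_sub_sq ℝ, ← real_inner_self_eq_norm_sq, ← real_inner_self_eq_norm_sq]
      have h1 := abs_le.1 (hin y hy y hy)
      have h2 := abs_le.1 (hin y hy z hz)
      have h3 := abs_le.1 (hin z hz z hz)
      simp only [RCLike.re_to_real]
      nlinarith [pow_pos hr 2]
    obtain ⟨v, hv⟩ := CompleteSpace.complete hC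
    exact ⟨v, hasDerivWithinAt_iff_tendsto_slope.2 hv⟩
  choose! F' hF' using key
  refine ⟨F', hF', partialFst (Icc c d) (partialSnd (Icc c d) k), hk2, fun x hx y hy => ?_⟩
  -- Differentiating `⟪F s, F t⟫ = k (s, t)` in `t`, then in `s`, identifies the kernel of `F'`,
  -- because derivatives within an interval are unique.
  have h1 : ∀ s ∈ Icc c d, ⟪F s, F' y⟫_ℝ = partialSnd (Icc c d) k (s, y) := fun s hs => by
    have e1 := ((hasDerivWithinAt_const y (Icc c d) (F s)).inner ℝ (hF' y hy)).congr
      (fun t ht => (hF s hs t ht).symm) (hF s hs y hy).symm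
    simp only [inner_zero_left, add_zero] at e1
    exact (hU y hy).eq_deriv _ e1 (hasDerivWithinAt_partialSnd hd0 hs hy)
  have e2 := ((hF' x hx).inner ℝ (hasDerivWithinAt_const x (Icc c d) (F' y))).congr
      (fun t ht => (h1 t ht).symm) (h1 x hx).symm
  simp only [inner_zero_right, zero_add] at e2
  exact (hU x hx).eq_deriv _ e2 (hasDerivWithinAt_partialFst hd1 hx hy)

theorem iteratedDerivWithin_eq_of_hasDerivWithinAt {E : Type*} [NormedAddCommGroup E]
    [NormedSpace ℝ E] (hD : UniqueDiffOn ℝ D) {g : ℕ → ℝ → E} {n : ℕ}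
    (hg : ∀ j < n, ∀ x ∈ D, HasDerivWithinAt (g j) (g (j + 1) x) D x) :
    ∀ j ≤ n, ∀ x ∈ D, iteratedDerivWithin j (g 0) D x = g j x := by
  intro j
  induction j with
  | zero => intro _ x _; simp
  | succ j ih =>
    intro hj x hx
    rw [iteratedDerivWithin_succ, derivWithin_congr (fun y hy => ih (by omega) y hy)
      (ih (by omega) x hx)]
    exact (hg j (by omega) x hx).derivWithin (hD x hx)

/-- Each derivative of the feature map costs two orders of its kernel, one in each variable. The
induction replaces `F` by `F'`, which is again a feature map, so both must be generalized. -/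
theorem exists_feature_derivatives_aux [CompleteSpace H] {c d : ℝ} (hcd : c < d) (n : ℕ) :
    ∀ {k : ℝ × ℝ → ℝ} (_ : ContDiffOn ℝ (2 * n : ℕ) k (Icc c d ×ˢ Icc c d)) {F : ℝ → H}
    (_ : ∀ x ∈ Icc c d, ∀ y ∈ Icc c d, ⟪F x, F y⟫_ℝ = k (x, y)),
    ∃ Φ : ℕ → ℝ → H, Φ 0 = F ∧
      ∀ j < n, ∀ x ∈ Icc c d, HasDerivWithinAt (Φ j) (Φ (j + 1) x) (Icc c d) x := by
  induction n with
  | zero => intro k _ F _; exact ⟨fun _ => F, rfl, by simp⟩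
  | succ n ih =>
    intro k hk F hF
    obtain ⟨F', hF', k', hk', hFk'⟩ :=
      exists_hasDerivWithinAt_of_kernel hcd (n := 2 * n) hk hF
    obtain ⟨Φ, h0, hΦ⟩ := ih hk' hFk'
    refine ⟨fun j => Nat.casesOn j F Φ, rfl, fun j hj x hx => ?_⟩
    cases j with
    | zero => simpa [h0] using hF' x hx
    | succ j => exact hΦ j (by omega) x hx

/-- Links the one-variable derivatives that define the norm to Fréchet partial derivatives on the
square, whose joint continuity follows from smoothness of `K`. -/
theorem kernelPartial_eq_iterate {c d : ℝ} (hcd : c < d) {K : ℝ → ℝ → ℝ} {n : ℕ}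
    (hK : ContDiffOn ℝ n (Function.uncurry K) (Icc c d ×ˢ Icc c d)) {i j : ℕ} (hij : i + j ≤ n)
    (hx : x ∈ Icc c d) (hy : y ∈ Icc c d) :
    kernelPartial (Icc c d) i j K x y =
      (partialFst (Icc c d))^[i] ((partialSnd (Icc c d))^[j] (Function.uncurry K)) (x, y) := by
  have hU := uniqueDiffOn_Icc hcd
  have hs : ∀ j ≤ n, ContDiffOn ℝ (n - j : ℕ)
      ((partialSnd (Icc c d))^[j] (Function.uncurry K)) (Icc c d ×ˢ Icc c d) := by
    intro j
    induction j with
    | zero => intro _; simpa using hK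
    | succ j ih =>
      intro hj
      rw [Function.iterate_succ_apply']
      refine contDiffOn_partialSnd hU ?_
      rw [show n - (j + 1) + 1 = n - j by omega]
      exact ih (by omega)
  have hf : ∀ i ≤ n - j, ContDiffOn ℝ (n - j - i : ℕ)
      ((partialFst (Icc c d))^[i] ((partialSnd (Icc c d))^[j] (Function.uncurry K)))
      (Icc c d ×ˢ Icc c d) := by
    intro i
    induction i with
    | zero => intro _; simpa using hs j (by omega)
    | succ i ih =>
      intro hj
      rw [Function.iterate_succ_apply']
      refine contDiffOn_partialFst hU ?_
      rw [show n - j - (i + 1) + 1 = n - j - i by omega]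
      exact ih (by omega)
  have e1 : ∀ s ∈ Icc c d, iteratedDerivWithin j (K s) (Icc c d) y
      = (partialSnd (Icc c d))^[j] (Function.uncurry K) (s, y) := fun s hs' =>
    iteratedDerivWithin_eq_of_hasDerivWithinAt hU
      (g := fun j t => (partialSnd (Icc c d))^[j] (Function.uncurry K) (s, t)) (n := j)
      (fun l hl t ht => by
        rw [Function.iterate_succ_apply']
        exact hasDerivWithinAt_partialSnd
          ((hs l (by omega)).differentiableOn (by norm_cast; omega)) hs' ht) j le_rfl y hy
  rw [kernelPartial, iteratedDerivWithin_congr e1 hx]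
  exact iteratedDerivWithin_eq_of_hasDerivWithinAt hU
      (g := fun i s => (partialFst (Icc c d))^[i] ((partialSnd (Icc c d))^[j]
        (Function.uncurry K)) (s, y)) (n := i)
      (fun l hl t ht => by
        rw [Function.iterate_succ_apply']
        exact hasDerivWithinAt_partialFst
          ((hf l (by omega)).differentiableOn (by norm_cast; omega)) ht hy) i le_rfl x hx

theorem continuousOn_kernelPartial {c d : ℝ} (hcd : c < d) {K : ℝ → ℝ → ℝ} {n : ℕ}
    (hK : ContDiffOn ℝ n (Function.uncurry K) (Icc c d ×ˢ Icc c d)) {i j : ℕ} (hij : i + j ≤ n) :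
    ContinuousOn (Function.uncurry (kernelPartial (Icc c d) i j K)) (Icc c d ×ˢ Icc c d) := by
  have hU := uniqueDiffOn_Icc hcd
  have hs : ∀ j {f : ℝ × ℝ → ℝ} {l : ℕ}, ContDiffOn ℝ (l + j : ℕ) f (Icc c d ×ˢ Icc c d) →
      ContDiffOn ℝ l ((partialSnd (Icc c d))^[j] f) (Icc c d ×ˢ Icc c d) := by
    intro j
    induction j with
    | zero => intro f l h; simpa using h
    | succ j ih => intro f l h; exact ih (contDiffOn_partialSnd hU h)
  have hf : ∀ j {f : ℝ × ℝ → ℝ} {l : ℕ}, ContDiffOn ℝ (l + j : ℕ) f (Icc c d ×ˢ Icc c d) →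
      ContDiffOn ℝ l ((partialFst (Icc c d))^[j] f) (Icc c d ×ˢ Icc c d) := by
    intro j
    induction j with
    | zero => intro f l h; simpa using h
    | succ j ih => intro f l h; exact ih (contDiffOn_partialFst hU h)
  refine (hf i (l := 0) (hs j (hK.of_le ?_))).continuousOn.congr fun p hp => ?_
  · norm_cast; omega
  · exact kernelPartial_eq_iterate hcd hK hij hp.1 hp.2

/-- Without boundedness the real `sSup` would be `0` and would not dominate any derivative. Finitely
many pairs `(i, j)` occur, each with a continuous function on a compact square. -/
theorem bddAbove_kernelNorm {c d : ℝ} (hcd : c < d) {K : ℝ → ℝ → ℝ} {n : ℕ}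
    (hK : ContDiffOn ℝ n (Function.uncurry K) (Icc c d ×ˢ Icc c d)) :
    BddAbove {r | ∃ i j : ℕ, i + j ≤ n ∧ ∃ x ∈ Icc c d, ∃ y ∈ Icc c d,
      r = |kernelPartial (Icc c d) i j K x y|} := by
  have hfin : ({p : ℕ × ℕ | p.1 + p.2 ≤ n}).Finite :=
    ((finite_Iic n).prod (finite_Iic n)).subset fun p hp => by
      change p.1 + p.2 ≤ n at hp
      exact ⟨by simp; omega, by simp; omega⟩
  have hb : BddAbove (⋃ p ∈ {p : ℕ × ℕ | p.1 + p.2 ≤ n},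
      (fun q : ℝ × ℝ => |Function.uncurry (kernelPartial (Icc c d) p.1 p.2 K) q|) ''
        (Icc c d ×ˢ Icc c d)) :=
    (hfin.bddAbove_biUnion).2 fun p hp =>
      (isCompact_Icc.prod isCompact_Icc).bddAbove_image
        (continuousOn_kernelPartial hcd hK hp).abs
  refine hb.mono ?_
  rintro r ⟨i, j, hij, x, hx, y, hy, rfl⟩
  exact mem_biUnion (x := (i, j)) hij ⟨(x, y), ⟨hx, hy⟩, rfl⟩

/-- A feature map of a `C⁶` kernel has three derivatives, bounded by `κ / √2`. -/
theorem exists_feature_derivatives [CompleteSpace H] {c d : ℝ} (hcd : c < d) {K : ℝ → ℝ → ℝ}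
    (hK : ContDiffOn ℝ 6 (Function.uncurry K) (Icc c d ×ˢ Icc c d)) {F : ℝ → H}
    (hF : ∀ x ∈ Icc c d, ∀ y ∈ Icc c d, ⟪F x, F y⟫_ℝ = K x y) :
    ∃ Φ : ℕ → ℝ → H, Φ 0 = F ∧
      (∀ j < 3, ∀ x ∈ Icc c d, HasDerivWithinAt (Φ j) (Φ (j + 1) x) (Icc c d) x) ∧
      ∀ j ≤ 3, ∀ x ∈ Icc c d, ‖Φ j x‖ ≤ kappa (Icc c d) K / √2 := by
  have hU := uniqueDiffOn_Icc hcd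
  obtain ⟨Φ, h0, hΦ⟩ := exists_feature_derivatives_aux (H := H) hcd 3
    (k := Function.uncurry K) (by exact_mod_cast hK) hF
  refine ⟨Φ, h0, hΦ, fun j hj x hx => ?_⟩
  have e1 : ∀ s ∈ Icc c d, iteratedDerivWithin j (K s) (Icc c d) x = ⟪Φ 0 s, Φ j x⟫_ℝ :=
    fun s hs => by
      rw [← iteratedDerivWithin_eq_of_hasDerivWithinAt hU (g := fun j t => ⟪Φ 0 s, Φ j t⟫_ℝ)
        (n := 3) (fun l hl t ht => by
          simpa using (hasDerivWithinAt_const t (Icc c d) (Φ 0 s)).inner ℝ (hΦ l hl t ht))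
        j hj x hx]
      refine iteratedDerivWithin_congr (fun t ht => ?_) hx
      simp only [h0]
      exact (hF s hs t ht).symm
  -- On the diagonal, `j` derivatives in each variable give `‖Φ j x‖²`; the total order `2 j ≤ 6`
  -- explains the class `C⁶`.
  have e2 : kernelPartial (Icc c d) j j K x x = ⟪Φ j x, Φ j x⟫_ℝ := by
    rw [kernelPartial, iteratedDerivWithin_congr e1 hx]
    exact iteratedDerivWithin_eq_of_hasDerivWithinAt hU (g := fun i s => ⟪Φ i s, Φ j x⟫_ℝ)
        (n := 3) (fun l hl t ht => by
          simpa using (hΦ l hl t ht).inner ℝ (hasDerivWithinAt_const t (Icc c d) (Φ j x)))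
        j hj x hx
  have h2 : ‖Φ j x‖ ^ 2 ≤ kernelNorm (Icc c d) 6 K := by
    refine le_csSup (bddAbove_kernelNorm hcd hK)
      ⟨j, j, by omega, x, hx, x, hx, ?_⟩
    rw [e2, real_inner_self_eq_norm_sq, abs_of_nonneg (sq_nonneg _)]
  rw [kappa, Real.sqrt_mul (by norm_num), mul_div_cancel_left₀ _ (by positivity)]
  exact Real.le_sqrt_of_sq_le h2

end Feature

/-! ### Bounded Lipschitz functions on the space-time rectangle -/

/-- `u` is bounded by `S` on `[0, T] × [a, b]`, with Lipschitz constant `X` in space and `Y` in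
time. -/
def LipBound (T a b : ℝ) (u : ℝ → ℝ → ℝ) (S X Y : ℝ) : Prop :=
  ∀ t ∈ Icc 0 T, ∀ x ∈ Icc a b, |u t x| ≤ S ∧
    ∀ s ∈ Icc 0 T, ∀ y ∈ Icc a b, |u t x - u s y| ≤ X * |x - y| + Y * |t - s|

namespace LipBound

variable {T a b : ℝ} {u v : ℝ → ℝ → ℝ} {S X Y S' X' Y' : ℝ}

theorem of_separate
    (hS : ∀ t ∈ Icc 0 T, ∀ x ∈ Icc a b, |u t x| ≤ S)
    (hX : ∀ t ∈ Icc 0 T, ∀ x ∈ Icc a b, ∀ y ∈ Icc a b, |u t x - u t y| ≤ X * |x - y|)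
    (hY : ∀ t ∈ Icc 0 T, ∀ s ∈ Icc 0 T, ∀ x ∈ Icc a b, |u t x - u s x| ≤ Y * |t - s|) :
    LipBound T a b u S X Y := fun t ht x hx => ⟨hS t ht x hx, fun s hs y hy =>
  (abs_sub_le _ (u t y) _).trans (add_le_add (hX t ht x hx y hy) (hY t ht s hs y hy))⟩

theorem congr (hu : LipBound T a b u S X Y)
    (h : ∀ t ∈ Icc 0 T, ∀ x ∈ Icc a b, v t x = u t x) : LipBound T a b v S X Y :=
  fun t ht x hx => by
    rw [h t ht x hx]
    refine ⟨(hu t ht x hx).1, fun s hs y hy => ?_⟩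
    rw [h s hs y hy]
    exact (hu t ht x hx).2 s hs y hy

theorem mono (hu : LipBound T a b u S X Y) (hS : S ≤ S') (hX : X ≤ X') (hY : Y ≤ Y') :
    LipBound T a b u S' X' Y' := fun t ht x hx =>
  ⟨(hu t ht x hx).1.trans hS, fun s hs y hy => ((hu t ht x hx).2 s hs y hy).trans (by gcongr)⟩

theorem add (hu : LipBound T a b u S X Y) (hv : LipBound T a b v S' X' Y') :
    LipBound T a b (fun t x => u t x + v t x) (S + S') (X + X') (Y + Y') := fun t ht x hx => by
  refine ⟨(abs_add_le _ _).trans (add_le_add (hu t ht x hx).1 (hv t ht x hx).1),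
    fun s hs y hy => ?_⟩
  have h1 := (hu t ht x hx).2 s hs y hy
  have h2 := (hv t ht x hx).2 s hs y hy
  have h3 := abs_add_le (u t x - u s y) (v t x - v s y)
  rw [show u t x + v t x - (u s y + v s y) = u t x - u s y + (v t x - v s y) by ring]
  linarith

theorem mul (hu : LipBound T a b u S X Y) (hv : LipBound T a b v S' X' Y') :
    LipBound T a b (fun t x => u t x * v t x) (S * S') (S * X' + X * S') (S * Y' + Y * S') :=
  fun t ht x hx => by
  have hS := (abs_nonneg _).trans (hu t ht x hx).1
  refine ⟨?_, fun s hs y hy => ?_⟩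
  · rw [abs_mul]
    exact mul_le_mul (hu t ht x hx).1 (hv t ht x hx).1 (abs_nonneg _) hS
  have h1 := (hu t ht x hx).2 s hs y hy
  have h2 := (hv t ht x hx).2 s hs y hy
  have h3 := abs_add_le (u t x * (v t x - v s y)) ((u t x - u s y) * v s y)
  rw [abs_mul, abs_mul] at h3
  have h4 := mul_le_mul (hu t ht x hx).1 h2 (abs_nonneg _) hS
  have h5 := mul_le_mul h1 (hv s hs y hy).1 (abs_nonneg _) ((abs_nonneg _).trans h1)
  rw [show u t x * v t x - u s y * v s y = u t x * (v t x - v s y) + (u t x - u s y) * v s y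
    by ring]
  linarith

theorem continuousOn (hu : LipBound T a b u S X Y) :
    ContinuousOn (Function.uncurry u) (Icc 0 T ×ˢ Icc a b) := by
  rintro ⟨t, x⟩ ⟨ht, hx⟩
  have hlim : Tendsto (fun q : ℝ × ℝ => X * |x - q.2| + Y * |t - q.1|)
      (𝓝[Icc 0 T ×ˢ Icc a b] (t, x)) (𝓝 0) := by
    have : ContinuousWithinAt (fun q : ℝ × ℝ => X * |x - q.2| + Y * |t - q.1|)
      (Icc 0 T ×ˢ Icc a b) (t, x) := by fun_prop
    simpa [ContinuousWithinAt] using this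
  refine tendsto_iff_dist_tendsto_zero.2 (squeeze_zero' (Eventually.of_forall fun _ => dist_nonneg)
    ?_ hlim)
  filter_upwards [self_mem_nhdsWithin] with q hq
  rw [dist_comm, Real.dist_eq]
  exact (hu t ht x hx).2 q.1 hq.1 q.2 hq.2

end LipBound

/-! ### Convolution with a density -/

theorem abs_sub_le_of_hasDerivWithinAt {c d C : ℝ} {u v : ℝ → ℝ}
    (hu : ∀ x ∈ Icc c d, HasDerivWithinAt u (v x) (Icc c d) x) (hv : ∀ x ∈ Icc c d, |v x| ≤ C)
    {x y : ℝ} (hx : x ∈ Icc c d) (hy : y ∈ Icc c d) : |u x - u y| ≤ C * |x - y| :=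
  (convex_Icc c d).norm_image_sub_le_of_norm_hasDerivWithin_le hu hv hy hx

/-- First-order Taylor estimate for a function with a Lipschitz derivative. -/
theorem abs_taylor_le {c d C : ℝ} {u v : ℝ → ℝ}
    (hu : ∀ x ∈ Icc c d, HasDerivWithinAt u (v x) (Icc c d) x)
    (hv : ∀ x ∈ Icc c d, ∀ y ∈ Icc c d, |v x - v y| ≤ C * |x - y|) (hC : 0 ≤ C)
    {x y : ℝ} (hx : x ∈ Icc c d) (hy : y ∈ Icc c d) :
    |u y - u x - (y - x) * v x| ≤ C * |y - x| ^ 2 := by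
  have hsub : uIcc x y ⊆ Icc c d := uIcc_subset_Icc hx hy
  have h := (convex_uIcc x y).norm_image_sub_le_of_norm_hasDerivWithin_le
    (f := fun s => u s - s * v x) (f' := fun s => v s - 1 * v x) (C := C * |y - x|)
    (fun s hs => ((hu s (hsub hs)).mono hsub).sub
      ((hasDerivWithinAt_id s _).mul_const (v x)))
    (fun s hs => by
      rw [Real.norm_eq_abs, one_mul]
      refine (hv s (hsub hs) x hx).trans ?_
      exact mul_le_mul_of_nonneg_left (abs_sub_left_of_mem_uIcc hs) hC) left_mem_uIcc right_mem_uIcc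
  rw [Real.norm_eq_abs, Real.norm_eq_abs] at h
  calc _ = |u y - y * v x - (u x - x * v x)| := by congr 1; ring
    _ ≤ C * |y - x| * |y - x| := h
    _ = _ := by ring

section Conv

variable {a b : ℝ} {r : ℝ → ℝ}

theorem sub_mem_Icc_of_mem {x y : ℝ} (hx : x ∈ Icc a b) (hy : y ∈ Icc a b) :
    x - y ∈ Icc (a - b) (b - a) :=
  ⟨by linarith [hx.1, hy.2], by linarith [hx.2, hy.1]⟩

theorem continuousOn_comp_sub {u : ℝ → ℝ} (hu : ContinuousOn u (Icc (a - b) (b - a))) {x : ℝ}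
    (hx : x ∈ Icc a b) : ContinuousOn (fun y => u (x - y)) (Icc a b) :=
  hu.comp (by fun_prop) fun _ hy => sub_mem_Icc_of_mem hx hy

theorem intervalIntegrable_conv (hab : a ≤ b) (hr : ContinuousOn r (Icc a b)) {u : ℝ → ℝ}
    (hu : ContinuousOn u (Icc (a - b) (b - a))) {x : ℝ} (hx : x ∈ Icc a b) :
    IntervalIntegrable (fun y => u (x - y) * r y) volume a b :=
  ((continuousOn_comp_sub hu hx).mul hr).intervalIntegrable_of_Icc hab

/-- Averaging against a probability density preserves a sup bound, so no factor `|Ω|` appears. -/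
theorem abs_conv_le (hab : a ≤ b) (hr : ContinuousOn r (Icc a b)) (hr0 : ∀ x ∈ Icc a b, 0 ≤ r x)
    (hr1 : ∫ x in a..b, r x = 1) {w : ℝ → ℝ} {C : ℝ} (hw : ∀ y ∈ Icc a b, |w y| ≤ C) :
    |∫ y in a..b, w y * r y| ≤ C := by
  have h := intervalIntegral.norm_integral_le_of_norm_le (μ := volume) (f := fun y => w y * r y)
    (g := fun y => C * r y) hab (Eventually.of_forall fun y hy => by
      have hy' := Ioc_subset_Icc_self hy
      rw [norm_mul, Real.norm_eq_abs, Real.norm_eq_abs, abs_of_nonneg (hr0 y hy')]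
      exact mul_le_mul_of_nonneg_right (hw y hy') (hr0 y hy'))
    ((continuousOn_const.mul hr).intervalIntegrable_of_Icc hab)
  rwa [intervalIntegral.integral_const_mul, hr1, mul_one] at h

/-- The Taylor remainder of `u` is quadratic uniformly in the integration variable, since `v` is
Lipschitz; integrated against the bounded density it stays `O(|y - x|²)`. -/
theorem hasDerivWithinAt_conv (hab : a ≤ b) (hr : ContinuousOn r (Icc a b)) {u v : ℝ → ℝ} {C : ℝ}
    (hu : ∀ x ∈ Icc (a - b) (b - a), HasDerivWithinAt u (v x) (Icc (a - b) (b - a)) x)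
    (hv : ∀ x ∈ Icc (a - b) (b - a), ∀ y ∈ Icc (a - b) (b - a), |v x - v y| ≤ C * |x - y|)
    (hC : 0 ≤ C) {x : ℝ} (hx : x ∈ Icc a b) :
    HasDerivWithinAt (conv a b u r) (conv a b v r x) (Icc a b) x := by
  have huc : ContinuousOn u (Icc (a - b) (b - a)) := fun x hx => (hu x hx).continuousWithinAt
  have hvc : ContinuousOn v (Icc (a - b) (b - a)) :=
    (LipschitzOnWith.of_dist_le_mul (K := ⟨C, hC⟩) fun x hx y hy => hv x hx y hy).continuousOn
  obtain ⟨R, hR⟩ := (isCompact_Icc.bddAbove_image hr.abs)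
  have hR' : ∀ y ∈ Icc a b, |r y| ≤ R := fun y hy => hR ⟨y, hy, rfl⟩
  rw [hasDerivWithinAt_iff_isLittleO]
  have hO : (fun y => conv a b u r y - conv a b u r x - (y - x) • conv a b v r x)
      =O[𝓝[Icc a b] x] fun y => ‖y - x‖ ^ 2 := by
    refine Asymptotics.IsBigO.of_bound (C * R * (b - a)) ?_
    filter_upwards [self_mem_nhdsWithin] with y hy
    have e : conv a b u r y - conv a b u r x - (y - x) • conv a b v r x
        = ∫ z in a..b, (u (y - z) - u (x - z) - (y - x) * v (x - z)) * r z := by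
      simp only [conv, smul_eq_mul]
      rw [← intervalIntegral.integral_const_mul, ← intervalIntegral.integral_sub
        (intervalIntegrable_conv hab hr huc hy) (intervalIntegrable_conv hab hr huc hx),
        ← intervalIntegral.integral_sub
          ((intervalIntegrable_conv hab hr huc hy).sub (intervalIntegrable_conv hab hr huc hx))
          ((intervalIntegrable_conv hab hr hvc hx).const_mul _)]
      congr 1
      ext z
      ring
    rw [e]
    have h := intervalIntegral.norm_integral_le_of_norm_le_const (a := a) (b := b)
      (f := fun z => (u (y - z) - u (x - z) - (y - x) * v (x - z)) * r z)
      (C := C * |y - x| ^ 2 * R) (fun z hz => by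
        rw [uIoc_of_le hab] at hz
        have hz' := Ioc_subset_Icc_self hz
        rw [norm_mul, Real.norm_eq_abs, Real.norm_eq_abs]
        have h1 := abs_taylor_le hu hv hC (sub_mem_Icc_of_mem hx hz') (sub_mem_Icc_of_mem hy hz')
        rw [sub_sub_sub_cancel_right] at h1
        exact mul_le_mul h1 (hR' z hz') (abs_nonneg _) (by positivity))
    refine h.trans (le_of_eq ?_)
    rw [abs_of_nonneg (by linarith : 0 ≤ b - a), norm_pow, norm_norm, Real.norm_eq_abs]
    ring
  refine hO.trans_isLittleO ?_
  exact (Asymptotics.isLittleO_pow_sub_sub x one_lt_two).mono nhdsWithin_le_nhds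

end Conv

/-! ### Derivatives of a density flow -/

section Flow

variable {T a b : ℝ} {ρ : ℝ → ℝ → ℝ}

theorem bddAbove_flowNorm {m n : ℕ} (hρ : IsFlowOfClass m n T a b ρ) :
    BddAbove {r | ∃ i ≤ m, ∃ j ≤ n, ∃ t ∈ Icc 0 T, ∃ x ∈ Icc a b,
      r = |flowPartial T a b i j ρ t x|} := by
  have hb : BddAbove (⋃ p ∈ Iic m ×ˢ Iic n,
      (fun q : ℝ × ℝ => |Function.uncurry (flowPartial T a b p.1 p.2 ρ) q|) ''
        (Icc 0 T ×ˢ Icc a b)) :=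
    (((finite_Iic m).prod (finite_Iic n)).bddAbove_biUnion).2 fun p hp =>
      (isCompact_Icc.prod isCompact_Icc).bddAbove_image
        (hρ.continuousOn_partial p.1 hp.1 p.2 hp.2).abs
  refine hb.mono ?_
  rintro r ⟨i, hi, j, hj, t, ht, x, hx, rfl⟩
  exact mem_biUnion (x := (i, j)) ⟨hi, hj⟩ ⟨(t, x), ⟨ht, hx⟩, rfl⟩

theorem abs_flowPartial_le_flowNorm {m n : ℕ} (hρ : IsFlowOfClass m n T a b ρ) {i j : ℕ}
    (hi : i ≤ m) (hj : j ≤ n) {t x : ℝ} (ht : t ∈ Icc 0 T) (hx : x ∈ Icc a b) :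
    |flowPartial T a b i j ρ t x| ≤ flowNorm m n T a b ρ :=
  le_csSup (bddAbove_flowNorm hρ) ⟨i, hi, j, hj, t, ht, x, hx, rfl⟩

theorem abs_flowPartial_le_timeDerivNorm {m n : ℕ} (hρ : IsFlowOfClass m n T a b ρ) (hm : 1 ≤ m)
    {t x : ℝ} (ht : t ∈ Icc 0 T) (hx : x ∈ Icc a b) :
    |flowPartial T a b 1 0 ρ t x| ≤ timeDerivNorm T a b ρ := by
  refine le_csSup ((bddAbove_flowNorm hρ).mono ?_) ⟨t, ht, x, hx, rfl⟩
  rintro r ⟨t, ht, x, hx, rfl⟩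
  exact ⟨1, hm, 0, Nat.zero_le n, t, ht, x, hx, rfl⟩

theorem flowPartial_zero_left (j : ℕ) (t x : ℝ) :
    flowPartial T a b 0 j ρ t x = iteratedDerivWithin j (ρ t) (Icc a b) x := by
  simp [flowPartial]

theorem flowPartial_zero_zero (t x : ℝ) : flowPartial T a b 0 0 ρ t x = ρ t x := by
  simp [flowPartial]

theorem hasDerivWithinAt_flowPartial_space (hab : a < b) {m n : ℕ}
    (hρ : IsFlowOfClass m n T a b ρ) {j : ℕ} (hj : j < n) {t x : ℝ} (ht : t ∈ Icc 0 T)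
    (hx : x ∈ Icc a b) :
    HasDerivWithinAt (flowPartial T a b 0 j ρ t) (flowPartial T a b 0 (j + 1) ρ t x)
      (Icc a b) x := by
  have h := ((hρ.contDiffOn_space t ht).differentiableOn_iteratedDerivWithin (m := j)
    (by exact_mod_cast hj) (uniqueDiffOn_Icc hab) x hx).hasDerivWithinAt
  rw [← iteratedDerivWithin_succ] at h
  rw [flowPartial_zero_left]
  exact h.congr (fun y _ => flowPartial_zero_left j t y) (flowPartial_zero_left j t x)

theorem hasDerivWithinAt_flowPartial_time {n : ℕ}
    (hρ : IsFlowOfClass 1 n T a b ρ) {j : ℕ} (hj : j ≤ n) {t x : ℝ} (ht : t ∈ Icc 0 T)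
    (hx : x ∈ Icc a b) :
    HasDerivWithinAt (fun s => flowPartial T a b 0 j ρ s x) (flowPartial T a b 1 j ρ t x)
      (Icc 0 T) t := by
  have h := ((hρ.contDiffOn_time j hj x hx).differentiableOn (by norm_num) t ht).hasDerivWithinAt
  rw [flowPartial, iteratedDerivWithin_one]
  exact h.congr (fun s _ => flowPartial_zero_left j s x) (flowPartial_zero_left j t x)

/-- The space constant comes from `∂ₓ^(j+1) ρ`, whence `j < n`, and the time constant from the mixed
derivative `∂ₜ ∂ₓʲ ρ`. -/
theorem lipBound_flowPartial (hab : a < b) {n : ℕ} (hρ : IsFlowOfClass 1 n T a b ρ) {j : ℕ}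
    (hj : j < n) : LipBound T a b (flowPartial T a b 0 j ρ) (flowNorm 1 n T a b ρ)
      (flowNorm 1 n T a b ρ) (flowNorm 1 n T a b ρ) :=
  .of_separate (fun _ ht _ hx => abs_flowPartial_le_flowNorm hρ (by simp) hj.le ht hx)
    (fun _ ht _ hx _ hy => abs_sub_le_of_hasDerivWithinAt
      (fun _ hx => hasDerivWithinAt_flowPartial_space hab hρ hj ht hx)
      (fun _ hx => abs_flowPartial_le_flowNorm hρ (by simp) hj ht hx) hx hy)
    (fun _ ht _ hs x hx => abs_sub_le_of_hasDerivWithinAt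
      (u := fun s => flowPartial T a b 0 j ρ s x)
      (fun _ ht => hasDerivWithinAt_flowPartial_time hρ hj.le ht hx)
      (fun _ ht => abs_flowPartial_le_flowNorm hρ (by simp) hj.le ht hx) ht hs)

theorem continuousOn_density {m n : ℕ} (hρ : IsFlowOfClass m n T a b ρ) {t : ℝ}
    (ht : t ∈ Icc 0 T) : ContinuousOn (ρ t) (Icc a b) :=
  (hρ.contDiffOn_space t ht).continuousOn

/-- The flow operator, with the derivatives carried out. -/
theorem flowOperator_eq (hab : a < b) {m : ℕ} (hρ : IsFlowOfClass m 2 T a b ρ)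
    {φ ψ : ℕ → ℝ → ℝ} {C : ℝ} (hC : 0 ≤ C)
    (hφ : ∀ j < 2, ∀ x ∈ Icc a b, HasDerivWithinAt (φ j) (φ (j + 1) x) (Icc a b) x)
    (hψ : ∀ j < 3, ∀ x ∈ Icc (a - b) (b - a),
      HasDerivWithinAt (ψ j) (ψ (j + 1) x) (Icc (a - b) (b - a)) x)
    (hψC : ∀ j ≤ 3, ∀ x ∈ Icc (a - b) (b - a), |ψ j x| ≤ C)
    {t x : ℝ} (ht : t ∈ Icc 0 T) (hx : x ∈ Icc a b) :
    flowOperator a b ρ (φ 0) (ψ 0) t x =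
      flowPartial T a b 0 1 ρ t x * (φ 1 x + conv a b (ψ 1) (ρ t) x)
        + flowPartial T a b 0 0 ρ t x * (φ 2 x + conv a b (ψ 2) (ρ t) x) := by
  have hU := uniqueDiffOn_Icc hab
  have hr := continuousOn_density hρ ht
  -- Differentiating `ψ j * ρ_t` uses that `ψ (j + 1)` is Lipschitz, hence a bound on `ψ (j + 2)`;
  -- for `j = 1` this is the third derivative of `ψ`.
  have hd : ∀ j < 2, ∀ y ∈ Icc a b, HasDerivWithinAt (fun y => φ j y + conv a b (ψ j) (ρ t) y)
      (φ (j + 1) y + conv a b (ψ (j + 1)) (ρ t) y) (Icc a b) y := fun j hj y hy =>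
    (hφ j hj y hy).add (hasDerivWithinAt_conv hab.le hr (hψ j (by omega))
      (fun _ hx _ hy => abs_sub_le_of_hasDerivWithinAt (hψ (j + 1) (by omega))
        (hψC (j + 2) (by omega)) hx hy) hC hy)
  have e : ∀ y ∈ Icc a b, ρ t y * derivWithin (fun y => φ 0 y + conv a b (ψ 0) (ρ t) y)
      (Icc a b) y = flowPartial T a b 0 0 ρ t y * (φ 1 y + conv a b (ψ 1) (ρ t) y) :=
    fun y hy => by rw [(hd 0 (by norm_num) y hy).derivWithin (hU y hy), flowPartial_zero_zero]
  rw [flowOperator, weightedLaplacian, derivWithin_congr e (e x hx)]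
  exact ((hasDerivWithinAt_flowPartial_space hab hρ (by norm_num) ht hx).mul
    (hd 1 (by norm_num) x hx)).derivWithin (hU x hx)

/-- In space all variation falls on `u` and `v`. In time only the density moves, and `|ρ_t - ρ_s| ≤
‖∂ₜρ‖ |t - s|` integrated over `Ω` produces the factor `|Ω| ‖∂ₜρ‖` seen in `C₁`. -/
theorem lipBound_drift (hab : a < b) {n : ℕ} (hρ : IsFlowOfClass 1 n T a b ρ)
    (hprob : IsProbabilityFlow T a b ρ) {u u' v v' : ℝ → ℝ} {C₁ C₂ : ℝ}
    (hu : ∀ x ∈ Icc a b, HasDerivWithinAt u (u' x) (Icc a b) x)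
    (huC : ∀ x ∈ Icc a b, |u x| ≤ C₁) (huC' : ∀ x ∈ Icc a b, |u' x| ≤ C₁)
    (hv : ∀ x ∈ Icc (a - b) (b - a), HasDerivWithinAt v (v' x) (Icc (a - b) (b - a)) x)
    (hvC : ∀ x ∈ Icc (a - b) (b - a), |v x| ≤ C₂)
    (hvC' : ∀ x ∈ Icc (a - b) (b - a), |v' x| ≤ C₂) :
    LipBound T a b (fun t x => u x + conv a b v (ρ t) x) (C₁ + C₂) (C₁ + C₂)
      (C₂ * ((b - a) * timeDerivNorm T a b ρ)) := by
  have hvc : ContinuousOn v (Icc (a - b) (b - a)) := fun x hx => (hv x hx).continuousWithinAt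
  refine .of_separate (fun t ht x hx => ?_) (fun t ht x hx y hy => ?_) (fun t ht s hs x hx => ?_)
  · have hr := continuousOn_density hρ ht
    exact (abs_add_le _ _).trans (add_le_add (huC x hx)
      (abs_conv_le hab.le hr (hprob t ht).1 (hprob t ht).2
        fun y hy => hvC _ (sub_mem_Icc_of_mem hx hy)))
  · have hr := continuousOn_density hρ ht
    have e : conv a b v (ρ t) x - conv a b v (ρ t) y
        = ∫ z in a..b, (v (x - z) - v (y - z)) * ρ t z := by
      rw [conv, conv, ← intervalIntegral.integral_sub (intervalIntegrable_conv hab.le hr hvc hx)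
        (intervalIntegrable_conv hab.le hr hvc hy)]
      simp only [sub_mul]
    have h1 : |conv a b v (ρ t) x - conv a b v (ρ t) y| ≤ C₂ * |x - y| := by
      rw [e]
      refine abs_conv_le hab.le hr (hprob t ht).1 (hprob t ht).2 fun z hz => ?_
      have := abs_sub_le_of_hasDerivWithinAt hv hvC' (sub_mem_Icc_of_mem hx hz)
        (sub_mem_Icc_of_mem hy hz)
      rwa [sub_sub_sub_cancel_right] at this
    have h2 := abs_sub_le_of_hasDerivWithinAt hu huC' hx hy
    have h3 := abs_add_le (u x - u y) (conv a b v (ρ t) x - conv a b v (ρ t) y)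
    rw [show u x + conv a b v (ρ t) x - (u y + conv a b v (ρ t) y)
      = u x - u y + (conv a b v (ρ t) x - conv a b v (ρ t) y) by ring]
    linarith
  · have e : u x + conv a b v (ρ t) x - (u x + conv a b v (ρ s) x)
        = ∫ z in a..b, v (x - z) * (ρ t z - ρ s z) := by
      rw [add_sub_add_left_eq_sub, conv, conv, ← intervalIntegral.integral_sub
        (intervalIntegrable_conv hab.le (continuousOn_density hρ ht) hvc hx)
        (intervalIntegrable_conv hab.le (continuousOn_density hρ hs) hvc hx)]
      simp only [mul_sub]
    rw [e]
    have h := intervalIntegral.norm_integral_le_of_norm_le_const (a := a) (b := b)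
      (f := fun z => v (x - z) * (ρ t z - ρ s z))
      (C := C₂ * (timeDerivNorm T a b ρ * |t - s|)) (fun z hz => by
        rw [uIoc_of_le hab.le] at hz
        have hz' := Ioc_subset_Icc_self hz
        have h1 := hvC _ (sub_mem_Icc_of_mem hx hz')
        rw [norm_mul, Real.norm_eq_abs, Real.norm_eq_abs]
        refine mul_le_mul h1 ?_ (abs_nonneg _) ((abs_nonneg _).trans h1)
        have := abs_sub_le_of_hasDerivWithinAt (u := fun s => flowPartial T a b 0 0 ρ s z)
          (fun _ ht => hasDerivWithinAt_flowPartial_time hρ (Nat.zero_le n) ht hz')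
          (fun _ ht => abs_flowPartial_le_timeDerivNorm hρ le_rfl ht hz') ht hs
        simpa only [flowPartial_zero_zero] using this)
    refine h.trans (le_of_eq ?_)
    rw [abs_of_nonneg (by linarith : 0 ≤ b - a)]
    ring

end Flow

/-! ### Quadrature on a uniform mesh -/

section Quadrature

theorem mem_Icc_mesh {a b : ℝ} (hab : a ≤ b) {N n : ℕ} (hn : n ≤ N) :
    a + n * ((b - a) / N) ∈ Icc a b := by
  have h1 : 0 ≤ (b - a) / N := div_nonneg (by linarith) (Nat.cast_nonneg N)
  refine ⟨by nlinarith [Nat.cast_nonneg (α := ℝ) n], ?_⟩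
  -- For `N = 0` the division returns `0` and the node is `a`.
  rcases Nat.eq_zero_or_pos N with rfl | hN
  · simpa using hab
  have h2 : (n : ℝ) * ((b - a) / N) ≤ N * ((b - a) / N) :=
    mul_le_mul_of_nonneg_right (by exact_mod_cast hn) h1
  rw [mul_div_cancel₀ _ (by positivity : (N : ℝ) ≠ 0)] at h2
  linarith

/-- The right-endpoint rule for a Lipschitz function. -/
theorem abs_integral_sub_mesh_sum_le {a b C : ℝ} (hab : a ≤ b) (hC : 0 ≤ C) {v : ℝ → ℝ}
    (hv : ∀ x ∈ Icc a b, ∀ y ∈ Icc a b, |v x - v y| ≤ C * |x - y|) {N : ℕ} (hN : 0 < N) :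
    |(∫ x in a..b, v x) - (b - a) / N * ∑ n ∈ Finset.Icc 1 N, v (a + n * ((b - a) / N))|
      ≤ (b - a) * (C * ((b - a) / N)) := by
  have hN' : (0 : ℝ) < N := by exact_mod_cast hN
  set δ := (b - a) / N with hδ
  have hδ0 : 0 ≤ δ := div_nonneg (by linarith) hN'.le
  have hmem : ∀ n ≤ N, a + n * δ ∈ Icc a b := fun n hn => mem_Icc_mesh hab hn
  have hvc : ContinuousOn v (Icc a b) :=
    (LipschitzOnWith.of_dist_le_mul (K := ⟨C, hC⟩) fun x hx y hy => hv x hx y hy).continuousOn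
  have hint : ∀ k < N, IntervalIntegrable v volume (a + k * δ) (a + (k + 1 : ℕ) * δ) :=
    fun k hk => (hvc.mono (uIcc_subset_Icc (hmem k hk.le) (hmem (k + 1) hk))).intervalIntegrable
  have hsum := intervalIntegral.sum_integral_adjacent_intervals hint
  have hend : a + (N : ℝ) * δ = b := by rw [hδ]; field_simp; ring
  rw [hend, Nat.cast_zero, zero_mul, add_zero] at hsum
  -- After the shift, node `k + 1` is the right endpoint of cell `k`; every point of the cell lies
  -- within `δ` of it.
  have hIcc : ∑ n ∈ Finset.Icc 1 N, v (a + n * δ)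
      = ∑ k ∈ Finset.range N, v (a + (k + 1 : ℕ) * δ) := by
    rw [Finset.range_eq_Ico, Finset.sum_Ico_add' (fun n : ℕ => v (a + n * δ)) 0 N 1]
    rfl
  rw [← hsum, hIcc, Finset.mul_sum, ← Finset.sum_sub_distrib]
  have hterm : ∀ k ∈ Finset.range N, |(∫ x in (a + k * δ)..(a + (k + 1 : ℕ) * δ), v x)
      - δ * v (a + (k + 1 : ℕ) * δ)| ≤ C * δ * δ := by
    intro k hk
    have hk' := Finset.mem_range.1 hk
    have hlen : a + (k + 1 : ℕ) * δ - (a + k * δ) = δ := by push_cast; ring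
    have h := intervalIntegral.norm_integral_le_of_norm_le_const (a := a + k * δ)
      (b := a + (k + 1 : ℕ) * δ) (f := fun x => v x - v (a + (k + 1 : ℕ) * δ)) (C := C * δ)
      (fun x hx => by
        rw [uIoc_of_le (by linarith)] at hx
        have hx' : x ∈ Icc a b := ⟨(hmem k hk'.le).1.trans hx.1.le, hx.2.trans (hmem (k + 1) hk').2⟩
        refine (hv x hx' _ (hmem (k + 1) hk')).trans (mul_le_mul_of_nonneg_left ?_ hC)
        rw [abs_le]
        constructor <;> linarith [hx.1, hx.2])
    rw [intervalIntegral.integral_sub (hint k hk') (by simp),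
      intervalIntegral.integral_const, hlen, abs_of_nonneg hδ0] at h
    exact h
  refine (Finset.abs_sum_le_sum_abs _ _).trans ((Finset.sum_le_sum hterm).trans (le_of_eq ?_))
  rw [Finset.sum_const, Finset.card_range, nsmul_eq_mul]
  rw [hδ]
  field_simp

variable {T a b : ℝ} {u v : ℝ → ℝ → ℝ} {S X Y S' X' Y' : ℝ}

namespace LipBound

theorem integrableOn (hu : LipBound T a b u S X Y) :
    IntegrableOn (Function.uncurry u) (Icc 0 T ×ˢ Icc a b) :=
  hu.continuousOn.integrableOn_compact (isCompact_Icc.prod isCompact_Icc)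

theorem continuousOn_space (hu : LipBound T a b u S X Y) {t : ℝ} (ht : t ∈ Icc 0 T) :
    ContinuousOn (u t) (Icc a b) :=
  hu.continuousOn.comp (f := fun x => (t, x)) (by fun_prop) fun _ hx => ⟨ht, hx⟩

theorem intervalIntegrable_space (hu : LipBound T a b u S X Y) (hab : a ≤ b) {t : ℝ}
    (ht : t ∈ Icc 0 T) : IntervalIntegrable (u t) volume a b :=
  (hu.continuousOn_space ht).intervalIntegrable_of_Icc hab

theorem abs_integral_sub_le (hu : LipBound T a b u S X Y) (hab : a ≤ b) {t s : ℝ}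
    (ht : t ∈ Icc 0 T) (hs : s ∈ Icc 0 T) :
    |(∫ x in a..b, u t x) - ∫ x in a..b, u s x| ≤ (b - a) * Y * |t - s| := by
  rw [← intervalIntegral.integral_sub (hu.intervalIntegrable_space hab ht)
    (hu.intervalIntegrable_space hab hs)]
  refine (intervalIntegral.norm_integral_le_of_norm_le_const (f := fun x => u t x - u s x)
    (C := Y * |t - s|) fun x hx => ?_).trans (le_of_eq ?_)
  · rw [uIoc_of_le hab] at hx
    have hx' := Ioc_subset_Icc_self hx
    simpa using (hu t ht x hx').2 s hs x hx'
  · rw [abs_of_nonneg (by linarith : 0 ≤ b - a)]; ring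

theorem intervalIntegrable_time (hu : LipBound T a b u S X Y) (hab : a ≤ b) (hT : 0 ≤ T)
    (hY : 0 ≤ Y) : IntervalIntegrable (fun t => ∫ x in a..b, u t x) volume 0 T :=
  ContinuousOn.intervalIntegrable_of_Icc hT
    (LipschitzOnWith.of_dist_le_mul (K := ⟨(b - a) * Y, mul_nonneg (by linarith) hY⟩)
      fun _ ht _ hs => hu.abs_integral_sub_le hab ht hs).continuousOn

theorem abs_integral_le (hu : LipBound T a b u S X Y) (hab : a ≤ b) (hT : 0 ≤ T) :
    |∫ t in (0 : ℝ)..T, ∫ x in a..b, u t x| ≤ T * (b - a) * S := by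
  refine (intervalIntegral.norm_integral_le_of_norm_le_const
    (f := fun t => ∫ x in a..b, u t x) (C := S * (b - a)) fun t ht => ?_).trans (le_of_eq ?_)
  · rw [uIoc_of_le hT] at ht
    refine (intervalIntegral.norm_integral_le_of_norm_le_const (f := fun x => u t x) (C := S)
      fun x hx => ?_).trans (le_of_eq ?_)
    · rw [uIoc_of_le hab] at hx
      exact (hu t (Ioc_subset_Icc_self ht) x (Ioc_subset_Icc_self hx)).1
    · rw [abs_of_nonneg (by linarith : 0 ≤ b - a)]
  · rw [sub_zero, abs_of_nonneg hT]; ring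

theorem abs_mesh_sum_le (hu : LipBound T a b u S X Y) (hab : a ≤ b) (hT : 0 ≤ T) {N L : ℕ}
    (hN : 0 < N) (hL : 0 < L) :
    |T * (b - a) / (N * L) * ∑ n ∈ Finset.Icc 1 N, ∑ l ∈ Finset.Icc 1 L,
      u (l * (T / L)) (a + n * ((b - a) / N))| ≤ T * (b - a) * S := by
  have hN' : (0 : ℝ) < N := by exact_mod_cast hN
  have hL' : (0 : ℝ) < L := by exact_mod_cast hL
  have hba : 0 ≤ b - a := by linarith
  have h : |∑ n ∈ Finset.Icc 1 N, ∑ l ∈ Finset.Icc 1 L,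
      u (l * (T / L)) (a + n * ((b - a) / N))| ≤ N * (L * S) := by
    refine (Finset.abs_sum_le_sum_abs _ _).trans ((Finset.sum_le_sum (g := fun _ => L * S)
      fun n hn => ?_).trans (le_of_eq (by simp)))
    refine (Finset.abs_sum_le_sum_abs _ _).trans ((Finset.sum_le_sum (g := fun _ => S)
      fun l hl => ?_).trans (le_of_eq (by simp)))
    have h1 := mem_Icc_mesh hT (Finset.mem_Icc.1 hl).2
    rw [zero_add, sub_zero] at h1
    exact (hu _ h1 _ (mem_Icc_mesh hab (Finset.mem_Icc.1 hn).2)).1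
  rw [abs_mul, abs_of_nonneg (by positivity)]
  refine (mul_le_mul_of_nonneg_left h (by positivity)).trans (le_of_eq ?_)
  field_simp

/-- The error of the product right-endpoint rule. -/
theorem abs_integral_sub_mesh_sum_le (hu : LipBound T a b u S X Y) (hab : a ≤ b) (hT : 0 ≤ T)
    (hX : 0 ≤ X) (hY : 0 ≤ Y) {N L : ℕ} (hN : 0 < N) (hL : 0 < L) :
    |(∫ t in (0 : ℝ)..T, ∫ x in a..b, u t x)
      - T * (b - a) / (N * L) * ∑ n ∈ Finset.Icc 1 N, ∑ l ∈ Finset.Icc 1 L,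
      u (l * (T / L)) (a + n * ((b - a) / N))| ≤
      T * (b - a) * (X * ((b - a) / N) + Y * (T / L)) := by
  have hL' : (0 : ℝ) < L := by exact_mod_cast hL
  have hba : 0 ≤ b - a := by linarith
  -- The one-dimensional rule is applied in time to the inner integral, which is `(b - a)
  -- Y`-Lipschitz; `h2` then applies it in space at each time node.
  have h1 := FlowLearning.abs_integral_sub_mesh_sum_le (v := fun t => ∫ x in a..b, u t x) hT
    (mul_nonneg hba hY) (fun t ht s hs => hu.abs_integral_sub_le hab ht hs) hL
  simp only [zero_add, sub_zero] at h1
  have h2 : |T / L * (∑ l ∈ Finset.Icc 1 L, ((∫ x in a..b, u (l * (T / L)) x)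
      - (b - a) / N * ∑ n ∈ Finset.Icc 1 N, u (l * (T / L)) (a + n * ((b - a) / N))))|
      ≤ T / L * (L * ((b - a) * (X * ((b - a) / N)))) := by
    rw [abs_mul, abs_of_nonneg (by positivity)]
    refine mul_le_mul_of_nonneg_left ?_ (by positivity)
    refine (Finset.abs_sum_le_sum_abs _ _).trans ((Finset.sum_le_sum
      (g := fun _ => (b - a) * (X * ((b - a) / N)))
      fun l hl => ?_).trans (le_of_eq (by simp)))
    have ht := mem_Icc_mesh hT (Finset.mem_Icc.1 hl).2
    rw [zero_add, sub_zero] at ht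
    exact FlowLearning.abs_integral_sub_mesh_sum_le hab hX (fun x hx y hy => by
      simpa using (hu _ ht x hx).2 _ ht y hy) hN
  rw [show T / L * (L * ((b - a) * (X * ((b - a) / N)))) = T * (b - a) * (X * ((b - a) / N)) by
    field_simp] at h2
  have e : (∫ t in (0 : ℝ)..T, ∫ x in a..b, u t x)
      - T * (b - a) / (N * L) * ∑ n ∈ Finset.Icc 1 N, ∑ l ∈ Finset.Icc 1 L,
      u (l * (T / L)) (a + n * ((b - a) / N))
      = ((∫ t in (0 : ℝ)..T, ∫ x in a..b, u t x)
        - T / L * ∑ l ∈ Finset.Icc 1 L, ∫ x in a..b, u (l * (T / L)) x)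
      + T / L * (∑ l ∈ Finset.Icc 1 L, ((∫ x in a..b, u (l * (T / L)) x)
      - (b - a) / N * ∑ n ∈ Finset.Icc 1 N, u (l * (T / L)) (a + n * ((b - a) / N)))) := by
    rw [Finset.sum_sub_distrib, ← Finset.mul_sum, Finset.sum_comm (s := Finset.Icc 1 N)]
    ring
  rw [e]
  refine (abs_add_le _ _).trans ((add_le_add h1 h2).trans (le_of_eq ?_))
  ring

theorem integral_add (hu : LipBound T a b u S X Y) (hv : LipBound T a b v S' X' Y')
    (hab : a ≤ b) (hT : 0 ≤ T) (hY : 0 ≤ Y) (hY' : 0 ≤ Y') :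
    ∫ t in (0 : ℝ)..T, ∫ x in a..b, (u t x + v t x)
      = (∫ t in (0 : ℝ)..T, ∫ x in a..b, u t x) + ∫ t in (0 : ℝ)..T, ∫ x in a..b, v t x := by
  rw [← intervalIntegral.integral_add (hu.intervalIntegrable_time hab hT hY)
    (hv.intervalIntegrable_time hab hT hY')]
  refine intervalIntegral.integral_congr fun t ht => ?_
  rw [uIcc_of_le hT] at ht
  exact intervalIntegral.integral_add (hu.intervalIntegrable_space hab ht)
    (hv.intervalIntegrable_space hab ht)

end LipBound

theorem integral_rectangle_congr (hab : a ≤ b) (hT : 0 ≤ T)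
    (h : ∀ t ∈ Icc 0 T, ∀ x ∈ Icc a b, u t x = v t x) :
    ∫ t in (0 : ℝ)..T, ∫ x in a..b, u t x = ∫ t in (0 : ℝ)..T, ∫ x in a..b, v t x := by
  refine intervalIntegral.integral_congr fun t ht => ?_
  rw [uIcc_of_le hT] at ht
  refine intervalIntegral.integral_congr fun x hx => ?_
  rw [uIcc_of_le hab] at hx
  exact h t ht x hx

end Quadrature

/-! ### Tikhonov regularization with a bounded symmetric form -/

section Tikhonov

variable {E : Type*} [NormedAddCommGroup E] [InnerProductSpace ℝ E]

/-- Riesz representation of a bounded bilinear form; symmetry supplies linearity in the second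
argument. -/
theorem exists_operator_of_form [CompleteSpace E] (β : E → E → ℝ)
    (hadd : ∀ p p' q, β (p + p') q = β p q + β p' q) (hsmul : ∀ (c : ℝ) p q, β (c • p) q = c * β p q)
    (hsymm : ∀ p q, β p q = β q p) (C : ℝ) (hC : ∀ p q, |β p q| ≤ C * (‖p‖ * ‖q‖)) :
    ∃ B : E →L[ℝ] E, ∀ p q, ⟪B p, q⟫_ℝ = β p q := by
  let b : E →ₗ[ℝ] E →ₗ[ℝ] ℝ := LinearMap.mk₂ ℝ β hadd hsmul
    (fun p q q' => by rw [hsymm, hadd, hsymm q, hsymm q'])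
    (fun c p q => by rw [hsymm, hsmul, hsymm q]; rfl)
  let b' : E →L[ℝ] E →L[ℝ] ℝ := b.mkContinuous₂ C fun p q => by
    rw [mul_assoc]; exact hC p q
  refine ⟨InnerProductSpace.continuousLinearMapOfBilin (𝕜 := ℝ) b', fun p q => ?_⟩
  rw [InnerProductSpace.continuousLinearMapOfBilin_apply]
  rfl

variable {B : E →L[ℝ] E} {lam : ℝ}

theorem inner_add_smul_one_apply (p q : E) :
    ⟪(B + lam • 1) p, q⟫_ℝ = ⟪B p, q⟫_ℝ + lam * ⟪p, q⟫_ℝ := by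
  simp [inner_add_left, inner_smul_left]

/-- Lax–Milgram: the form of `B + lam` is coercive with constant `lam`. -/
theorem isUnit_add_smul_one [CompleteSpace E] (hB : ∀ p, 0 ≤ ⟪B p, p⟫_ℝ) (hlam : 0 < lam) :
    IsUnit (B + lam • 1 : E →L[ℝ] E) := by
  let b : E →L[ℝ] E →L[ℝ] ℝ := (innerSL ℝ).comp (B + lam • 1 : E →L[ℝ] E)
  have hb : ∀ p q, b p q = ⟪(B + lam • 1) p, q⟫_ℝ := fun p q => rfl
  have hco : IsCoercive b := ⟨lam, hlam, fun p => by
    rw [hb, inner_add_smul_one_apply, real_inner_self_eq_norm_mul_norm]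
    linarith [hB p]⟩
  have e : (B + lam • 1 : E →L[ℝ] E) = hco.continuousLinearEquivOfBilin := by
    ext p
    exact hco.unique_continuousLinearEquivOfBilin fun w => (hb p w).symm
  rw [e]
  exact (ContinuousLinearEquiv.unitsEquiv ℝ E).symm hco.continuousLinearEquivOfBilin |>.isUnit

theorem add_smul_one_ringInverse_apply [CompleteSpace E] (hB : ∀ p, 0 ≤ ⟪B p, p⟫_ℝ) (hlam : 0 < lam) (p : E) :
    (B + lam • 1) (Ring.inverse (B + lam • 1) p) = p := by
  rw [← mul_apply_eq_comp, Ring.mul_inverse_cancel _ (isUnit_add_smul_one hB hlam)]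
  rfl

theorem norm_le_of_add_smul_one_apply (hB : ∀ p, 0 ≤ ⟪B p, p⟫_ℝ) (p : E) :
    lam * ‖p‖ ≤ ‖(B + lam • 1) p‖ := by
  rcases eq_or_ne p 0 with rfl | hp
  · simp
  have h1 : lam * ‖p‖ * ‖p‖ ≤ ‖(B + lam • 1) p‖ * ‖p‖ := by
    refine le_trans ?_ (real_inner_le_norm _ _)
    rw [inner_add_smul_one_apply, real_inner_self_eq_norm_mul_norm]
    linarith [hB p]
  exact le_of_mul_le_mul_right h1 (norm_pos_iff.2 hp)

/-- The regularized least squares problem has the minimizer `(B + lam)⁻¹ B p₀`. -/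
theorem isUniqueMinimizer_ringInverse [CompleteSpace E] (hB : ∀ p, 0 ≤ ⟪B p, p⟫_ℝ)
    (hsymm : ∀ p q, ⟪B p, q⟫_ℝ = ⟪B q, p⟫_ℝ) (hlam : 0 < lam) (p₀ : E) :
    IsUniqueMinimizer (fun p => ⟪B (p - p₀), p - p₀⟫_ℝ + lam * ‖p‖ ^ 2)
      (Ring.inverse (B + lam • 1) (B p₀)) := by
  intro q hq
  have hp := add_smul_one_ringInverse_apply hB hlam (B p₀)
  set p := Ring.inverse (B + lam • 1) (B p₀) with hpdef
  obtain ⟨d, rfl⟩ : ∃ d, q = p + d := ⟨q - p, by abel⟩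
  have hd : d ≠ 0 := by rintro rfl; simp at hq
  -- The normal equation tested against `d` cancels the terms linear in `d`; the loss then grows by
  -- `⟪B d, d⟫ + lam ‖d‖²`.
  have h0 : ⟪B p, d⟫_ℝ + lam * ⟪p, d⟫_ℝ = ⟪B p₀, d⟫_ℝ := by
    rw [← inner_add_smul_one_apply, hp]
  have e1 : ⟪B (p + d - p₀), p + d - p₀⟫_ℝ
      = ⟪B (p - p₀), p - p₀⟫_ℝ + 2 * (⟪B p, d⟫_ℝ - ⟪B p₀, d⟫_ℝ) + ⟪B d, d⟫_ℝ := by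
    rw [show p + d - p₀ = (p - p₀) + d by abel, map_add, inner_add_left, inner_add_right,
      inner_add_right, hsymm d (p - p₀), map_sub, inner_sub_left _ _ d]
    ring
  have e2 : ‖p + d‖ ^ 2 = ‖p‖ ^ 2 + 2 * ⟪p, d⟫_ℝ + ‖d‖ ^ 2 := norm_add_sq_real p d
  have h2 : 0 < lam * ‖d‖ ^ 2 := by have := norm_pos_iff.2 hd; positivity
  simp only [e1, e2]
  nlinarith [hB d]

/-- Perturbation of the regularized solution under a perturbation of the form. -/
theorem norm_ringInverse_sub_le [CompleteSpace E] {B' : E →L[ℝ] E} (hB : ∀ p, 0 ≤ ⟪B p, p⟫_ℝ)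
    (hB' : ∀ p, 0 ≤ ⟪B' p, p⟫_ℝ) (hlam : 0 < lam) {ε : ℝ} (hε : 0 ≤ ε)
    (h : ∀ p q, |⟪B p, q⟫_ℝ - ⟪B' p, q⟫_ℝ| ≤ ε * (‖p‖ * ‖q‖)) (p₀ : E) :
    ‖Ring.inverse (B' + lam • 1) (B' p₀) - Ring.inverse (B + lam • 1) (B p₀)‖
      ≤ ε * lam⁻¹ * ‖p₀‖ := by
  have hp := add_smul_one_ringInverse_apply hB hlam (B p₀)
  have hp' := add_smul_one_ringInverse_apply hB' hlam (B' p₀)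
  set p := Ring.inverse (B + lam • 1) (B p₀)
  set p' := Ring.inverse (B' + lam • 1) (B' p₀)
  have hap : ∀ (A : E →L[ℝ] E) (v : E), (A + lam • 1) v = A v + lam • v := fun A v => by simp
  have e1 : (B + lam • 1) (p₀ - p) = lam • p₀ := by
    rw [map_sub, hp, hap]; abel
  have h1 : ‖p₀ - p‖ ≤ ‖p₀‖ := by
    have := norm_le_of_add_smul_one_apply (lam := lam) hB (p₀ - p)
    rw [e1, norm_smul, Real.norm_of_nonneg hlam.le] at this
    exact le_of_mul_le_mul_left this hlam
  have e2 : (B' + lam • 1) (p' - p) = B' (p₀ - p) - B (p₀ - p) := by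
    have hp2 : lam • p = B p₀ - B p := by rw [← hp, hap]; abel
    rw [map_sub, hp', hap, hp2, map_sub, map_sub]; abel
  have h2 : ‖B' (p₀ - p) - B (p₀ - p)‖ ≤ ε * ‖p₀ - p‖ := by
    -- Testing the form estimate against `w` itself turns it into a norm estimate.
    set w := B' (p₀ - p) - B (p₀ - p) with hw
    rcases eq_or_ne w 0 with h0 | h0
    · rw [h0, norm_zero]; positivity
    refine le_of_mul_le_mul_right ?_ (norm_pos_iff.2 h0)
    rw [← real_inner_self_eq_norm_mul_norm, mul_assoc]
    nth_rewrite 1 [hw]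
    rw [inner_sub_left]
    exact (le_abs_self _).trans ((abs_sub_comm _ _).trans_le (h _ _))
  have h3 := norm_le_of_add_smul_one_apply (lam := lam) hB' (p' - p)
  rw [e2] at h3
  have h4 : lam * ‖p' - p‖ ≤ ε * ‖p₀‖ :=
    h3.trans (h2.trans (mul_le_mul_of_nonneg_left h1 hε))
  rw [mul_right_comm, ← div_eq_mul_inv, le_div_iff₀ hlam, mul_comm]
  exact h4

end Tikhonov

/-! ### The flow operator on a pair of reproducing kernel Hilbert spaces -/

section Operator

/-- By the reproducing property `φ x` is an inner product with the feature at `x`, so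
differentiating the feature map differentiates every `φ` at once, with bounds linear in `‖φ‖`. -/
theorem exists_rkhs_derivatives {H : Type*} [NormedAddCommGroup H] [InnerProductSpace ℝ H]
    [CompleteSpace H] [RKHS ℝ H ℝ ℝ] {c d : ℝ} (hcd : c < d) {K : ℝ → ℝ → ℝ}
    (hK : ContDiffOn ℝ 6 (Function.uncurry K) (Icc c d ×ˢ Icc c d))
    (hH : ∀ x y : ℝ, RKHS.kernel H x y 1 = K x y) :
    ∃ Φ : ℕ → ℝ → H, (∀ (φ : H) x, ⟪Φ 0 x, φ⟫_ℝ = φ x) ∧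
      (∀ j < 3, ∀ (φ : H), ∀ x ∈ Icc c d,
        HasDerivWithinAt (fun s => ⟪Φ j s, φ⟫_ℝ) ⟪Φ (j + 1) x, φ⟫_ℝ (Icc c d) x) ∧
      ∀ j ≤ 3, ∀ (φ : H), ∀ x ∈ Icc c d, |⟪Φ j x, φ⟫_ℝ| ≤ kappa (Icc c d) K / √2 * ‖φ‖ := by
  obtain ⟨Φ, h0, hd, hb⟩ := exists_feature_derivatives hcd hK
    (F := fun x => RKHS.kerFun H x (1 : ℝ)) (fun x _ y _ => by
      rw [RKHS.kerFun_inner, RKHS.kerFun_apply, hH]; simp)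
  refine ⟨Φ, fun φ x => ?_, fun j hj φ x hx => ?_, fun j hj φ x hx => ?_⟩
  · rw [h0, RKHS.kerFun_inner]; simp
  · simpa using (hd j hj x hx).inner ℝ (hasDerivWithinAt_const x (Icc c d) φ)
  · exact (abs_real_inner_le_norm _ _).trans
      (mul_le_mul_of_nonneg_right (hb j hj x hx) (norm_nonneg _))

theorem flowNorm_nonneg (m n : ℕ) (T a b : ℝ) (ρ : ℝ → ℝ → ℝ) : 0 ≤ flowNorm m n T a b ρ :=
  Real.sSup_nonneg (by rintro _ ⟨i, _, j, _, t, _, x, _, rfl⟩; exact abs_nonneg _)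

theorem timeDerivNorm_nonneg (T a b : ℝ) (ρ : ℝ → ℝ → ℝ) : 0 ≤ timeDerivNorm T a b ρ :=
  Real.sSup_nonneg (by rintro _ ⟨t, _, x, _, rfl⟩; exact abs_nonneg _)

variable {H₁ H₂ : Type*}
  [NormedAddCommGroup H₁] [InnerProductSpace ℝ H₁] [CompleteSpace H₁] [RKHS ℝ H₁ ℝ ℝ]
  [NormedAddCommGroup H₂] [InnerProductSpace ℝ H₂] [CompleteSpace H₂] [RKHS ℝ H₂ ℝ ℝ]

/-- The flow operator is linear, and its values are bounded and Lipschitz. -/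
theorem flowOperator_linear_and_lipBound {a b T : ℝ} (hab : a < b) {K₁ K₂ : ℝ → ℝ → ℝ}
    (hK₁s : ContDiffOn ℝ 6 (Function.uncurry K₁) (Icc a b ×ˢ Icc a b))
    (hK₂s : ContDiffOn ℝ 6 (Function.uncurry K₂) (Icc (a - b) (b - a) ×ˢ Icc (a - b) (b - a)))
    (hH₁ : ∀ x y : ℝ, RKHS.kernel H₁ x y 1 = K₁ x y)
    (hH₂ : ∀ x y : ℝ, RKHS.kernel H₂ x y 1 = K₂ x y)
    {ρ : ℝ → ℝ → ℝ} (hρ : IsFlowOfClass 1 2 T a b ρ) (hprob : IsProbabilityFlow T a b ρ) :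
    (∀ p q : WithLp 2 (H₁ × H₂), ∀ t ∈ Icc 0 T, ∀ x ∈ Icc a b,
      flowOperator a b ρ (p + q).fst (p + q).snd t x
        = flowOperator a b ρ p.fst p.snd t x + flowOperator a b ρ q.fst q.snd t x) ∧
    (∀ (c : ℝ) (p : WithLp 2 (H₁ × H₂)), ∀ t ∈ Icc 0 T, ∀ x ∈ Icc a b,
      flowOperator a b ρ (c • p).fst (c • p).snd t x = c * flowOperator a b ρ p.fst p.snd t x) ∧
    ∀ p : WithLp 2 (H₁ × H₂), ∀ G, G = (kappa (Icc a b) K₁ + kappa (Icc (a - b) (b - a)) K₂)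
        / √2 * ‖p‖ → LipBound T a b (flowOperator a b ρ p.fst p.snd)
      (2 * flowNorm 1 2 T a b ρ * G) (4 * flowNorm 1 2 T a b ρ * G)
      (2 * flowNorm 1 2 T a b ρ * G * (1 + (b - a) * timeDerivNorm T a b ρ)) := by
  obtain ⟨Φ, hΦ0, hΦd, hΦb⟩ := exists_rkhs_derivatives hab hK₁s hH₁
  obtain ⟨Ψ, hΨ0, hΨd, hΨb⟩ := exists_rkhs_derivatives (by linarith : a - b < b - a) hK₂s hH₂
  have hκ₁ : 0 ≤ kappa (Icc a b) K₁ / √2 := div_nonneg (Real.sqrt_nonneg _) (Real.sqrt_nonneg _)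
  have hκ₂ : 0 ≤ kappa (Icc (a - b) (b - a)) K₂ / √2 :=
    div_nonneg (Real.sqrt_nonneg _) (Real.sqrt_nonneg _)
  set M := flowNorm 1 2 T a b ρ
  have hM : 0 ≤ M := flowNorm_nonneg 1 2 T a b ρ
  have hE : 0 ≤ (b - a) * timeDerivNorm T a b ρ :=
    mul_nonneg (by linarith) (timeDerivNorm_nonneg T a b ρ)
  -- For `j ≤ 2`, `g j p t` plays the role of the `j`-th space derivative of `φ + ψ * ρ_t`.
  let g : ℕ → WithLp 2 (H₁ × H₂) → ℝ → ℝ → ℝ := fun j p t x =>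
    ⟪Φ j x, p.fst⟫_ℝ + conv a b (fun z => ⟪Ψ j z, p.snd⟫_ℝ) (ρ t) x
  have hA : ∀ p : WithLp 2 (H₁ × H₂), ∀ t ∈ Icc 0 T, ∀ x ∈ Icc a b,
      flowOperator a b ρ p.fst p.snd t x
        = flowPartial T a b 0 1 ρ t x * g 1 p t x + flowPartial T a b 0 0 ρ t x * g 2 p t x := by
    intro p t ht x hx
    have h := flowOperator_eq hab hρ (φ := fun j x => ⟪Φ j x, p.fst⟫_ℝ)
      (ψ := fun j x => ⟪Ψ j x, p.snd⟫_ℝ)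
      (C := kappa (Icc (a - b) (b - a)) K₂ / √2 * ‖p.snd‖) (by positivity)
      (fun j hj => hΦd j (by omega) p.fst) (fun j hj => hΨd j hj p.snd)
      (fun j hj => hΨb j hj p.snd) ht hx
    simpa only [hΦ0, hΨ0] using h
  have hΨc : ∀ j < 3, ∀ p : WithLp 2 (H₁ × H₂),
      ContinuousOn (fun z => ⟪Ψ j z, p.snd⟫_ℝ) (Icc (a - b) (b - a)) :=
    fun j hj p x hx => (hΨd j hj p.snd x hx).continuousWithinAt
  have hgadd : ∀ j < 3, ∀ p q : WithLp 2 (H₁ × H₂), ∀ t ∈ Icc 0 T, ∀ x ∈ Icc a b,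
      g j (p + q) t x = g j p t x + g j q t x := by
    intro j hj p q t ht x hx
    have hr := continuousOn_density hρ ht
    simp only [g, conv, WithLp.add_fst, WithLp.add_snd, inner_add_right, add_mul]
    rw [intervalIntegral.integral_add
      (intervalIntegrable_conv hab.le hr (hΨc j hj p) hx)
      (intervalIntegrable_conv hab.le hr (hΨc j hj q) hx)]
    ring
  have hgsmul : ∀ j, ∀ (c : ℝ) (p : WithLp 2 (H₁ × H₂)), ∀ t x,
      g j (c • p) t x = c * g j p t x := by
    intro j c p t x
    simp only [g, conv, WithLp.smul_fst, WithLp.smul_snd, inner_smul_right, mul_assoc]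
    rw [intervalIntegral.integral_const_mul]
    ring
  refine ⟨fun p q t ht x hx => ?_, fun c p t ht x hx => ?_, fun p G hG => ?_⟩
  · rw [hA _ t ht x hx, hA _ t ht x hx, hA _ t ht x hx, hgadd 1 (by norm_num) p q t ht x hx,
      hgadd 2 (by norm_num) p q t ht x hx]
    ring
  · rw [hA _ t ht x hx, hA _ t ht x hx, hgsmul, hgsmul]
    ring
  · have hp1 : ‖p.fst‖ ≤ ‖p‖ := WithLp.norm_fst_le _ p
    have hp2 : ‖p.snd‖ ≤ ‖p‖ := WithLp.norm_snd_le _ p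
    have hG0 : 0 ≤ G := by rw [hG, add_div]; positivity
    have hG2 : kappa (Icc (a - b) (b - a)) K₂ / √2 * ‖p‖ ≤ G := by
      rw [hG, add_div, add_mul]
      have : 0 ≤ kappa (Icc a b) K₁ / √2 * ‖p‖ := by positivity
      linarith
    have hg : ∀ j < 3, LipBound T a b (g j p) G G (G * ((b - a) * timeDerivNorm T a b ρ)) := by
      intro j hj
      have h1 : ∀ j ≤ 3, ∀ x ∈ Icc a b, |⟪Φ j x, p.fst⟫_ℝ| ≤ kappa (Icc a b) K₁ / √2 * ‖p‖ :=
        fun j hj x hx => (hΦb j hj _ x hx).trans (by gcongr)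
      have h2 : ∀ j ≤ 3, ∀ x ∈ Icc (a - b) (b - a),
          |⟪Ψ j x, p.snd⟫_ℝ| ≤ kappa (Icc (a - b) (b - a)) K₂ / √2 * ‖p‖ :=
        fun j hj x hx => (hΨb j hj _ x hx).trans (by gcongr)
      have e : kappa (Icc a b) K₁ / √2 * ‖p‖ + kappa (Icc (a - b) (b - a)) K₂ / √2 * ‖p‖ = G := by
        rw [hG]; ring
      exact (lipBound_drift hab hρ hprob (hΦd j hj p.fst) (h1 j hj.le) (h1 (j + 1) hj)
        (hΨd j hj p.snd) (h2 j hj.le) (h2 (j + 1) hj)).mono e.le e.le (by gcongr)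
    -- Each of the two products contributes `M G` to the sup bound, `2 M G` in space and `M G (1 +
    -- |Ω| ‖∂ₜρ‖)` in time.
    refine ((((lipBound_flowPartial hab hρ (j := 1) (by norm_num)).mul (hg 1 (by norm_num))).add
      ((lipBound_flowPartial hab hρ (j := 0) (by norm_num)).mul (hg 2 (by norm_num)))).congr
        (hA p)).mono (le_of_eq ?_) (le_of_eq ?_) (le_of_eq ?_) <;> ring

end Operator

/-! ### Comparison of the expected and the sampled form -/

section Forms

variable {E : Type*} [NormedAddCommGroup E] [InnerProductSpace ℝ E] [CompleteSpace E]

/-- A linear operator with values in bounded Lipschitz functions on `[0, T] × [a, b]`, for the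
weighted `L²` form and its sampled version on a uniform mesh. -/
theorem exists_operators_of_lipBound {a b T : ℝ} (hab : a ≤ b) (hT : 0 ≤ T) {N L : ℕ}
    (hN : 0 < N) (hL : 0 < L) {r : ℝ → ℝ → ℝ} (hr : ∀ t ∈ Icc 0 T, ∀ x ∈ Icc a b, 0 ≤ r t x)
    {A : E → ℝ → ℝ → ℝ}
    (hadd : ∀ p q, ∀ t ∈ Icc 0 T, ∀ x ∈ Icc a b, A (p + q) t x = A p t x + A q t x)
    (hsmul : ∀ (c : ℝ) p, ∀ t ∈ Icc 0 T, ∀ x ∈ Icc a b, A (c • p) t x = c * A p t x)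
    {S X Y : ℝ} (hX : 0 ≤ X) (hY : 0 ≤ Y)
    (hA : ∀ p q, LipBound T a b (fun t x => A p t x * A q t x * r t x)
      (S * (‖p‖ * ‖q‖)) (X * (‖p‖ * ‖q‖)) (Y * (‖p‖ * ‖q‖))) :
    ∃ B B' : E →L[ℝ] E,
      (∀ p q, ⟪B p, q⟫_ℝ = ∫ t in (0 : ℝ)..T, ∫ x in a..b, A p t x * A q t x * r t x) ∧
      (∀ p q, ⟪B' p, q⟫_ℝ = T * (b - a) / (N * L) * ∑ n ∈ Finset.Icc 1 N, ∑ l ∈ Finset.Icc 1 L,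
        A p (l * (T / L)) (a + n * ((b - a) / N)) * A q (l * (T / L)) (a + n * ((b - a) / N))
          * r (l * (T / L)) (a + n * ((b - a) / N))) ∧
      (∀ p, 0 ≤ ⟪B p, p⟫_ℝ) ∧ (∀ p, 0 ≤ ⟪B' p, p⟫_ℝ) ∧
      (∀ p q, |⟪B p, q⟫_ℝ - ⟪B' p, q⟫_ℝ| ≤ 2 * (T * (b - a) * S) * (‖p‖ * ‖q‖)) ∧
      ∀ p q, |⟪B p, q⟫_ℝ - ⟪B' p, q⟫_ℝ|
        ≤ T * (b - a) * (X * ((b - a) / N) + Y * (T / L)) * (‖p‖ * ‖q‖) := by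
  have hba : 0 ≤ b - a := by linarith
  have htl : ∀ l ∈ Finset.Icc 1 L, (l : ℝ) * (T / L) ∈ Icc 0 T := fun l hl => by
    simpa using mem_Icc_mesh hT (Finset.mem_Icc.1 hl).2
  have hxn : ∀ n ∈ Finset.Icc 1 N, a + (n : ℝ) * ((b - a) / N) ∈ Icc a b := fun n hn =>
    mem_Icc_mesh hab (Finset.mem_Icc.1 hn).2
  obtain ⟨B, hB⟩ := exists_operator_of_form (E := E)
    (fun p q => ∫ t in (0 : ℝ)..T, ∫ x in a..b, A p t x * A q t x * r t x)
    (fun p p' q => by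
      rw [← (hA p q).integral_add (hA p' q) hab hT (by positivity) (by positivity)]
      refine integral_rectangle_congr hab hT fun t ht x hx => ?_
      rw [hadd p p' t ht x hx]; ring)
    (fun c p q => by
      simp only [← intervalIntegral.integral_const_mul]
      refine integral_rectangle_congr hab hT fun t ht x hx => ?_
      rw [hsmul c p t ht x hx]; ring)
    (fun p q => by simp only [mul_comm (A p _ _)])
    (T * (b - a) * S) (fun p q => by
      rw [mul_assoc]; exact (hA p q).abs_integral_le hab hT)
  obtain ⟨B', hB'⟩ := exists_operator_of_form (E := E)
    (fun p q => T * (b - a) / (N * L) * ∑ n ∈ Finset.Icc 1 N, ∑ l ∈ Finset.Icc 1 L,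
        A p (l * (T / L)) (a + n * ((b - a) / N)) * A q (l * (T / L)) (a + n * ((b - a) / N))
          * r (l * (T / L)) (a + n * ((b - a) / N)))
    (fun p p' q => by
      rw [← mul_add, ← Finset.sum_add_distrib]
      refine congrArg (T * (b - a) / (N * L) * ·) (Finset.sum_congr rfl fun n hn => ?_)
      rw [← Finset.sum_add_distrib]
      refine Finset.sum_congr rfl fun l hl => ?_
      rw [hadd p p' _ (htl l hl) _ (hxn n hn)]; ring)
    (fun c p q => by
      rw [mul_left_comm, Finset.mul_sum _ _ c]
      refine congrArg (T * (b - a) / (N * L) * ·) (Finset.sum_congr rfl fun n hn => ?_)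
      rw [Finset.mul_sum]
      refine Finset.sum_congr rfl fun l hl => ?_
      rw [hsmul c p _ (htl l hl) _ (hxn n hn)]; ring)
    (fun p q => by simp only [mul_comm (A p _ _)])
    (T * (b - a) * S) (fun p q => by
      rw [mul_assoc]; exact (hA p q).abs_mesh_sum_le hab hT hN hL)
  refine ⟨B, B', hB, hB', fun p => ?_, fun p => ?_, fun p q => ?_, fun p q => ?_⟩
  · rw [hB]
    refine intervalIntegral.integral_nonneg hT fun t ht =>
      intervalIntegral.integral_nonneg hab fun x hx => ?_
    exact mul_nonneg (mul_self_nonneg _) (hr t ht x hx)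
  · rw [hB']
    refine mul_nonneg (by positivity) (Finset.sum_nonneg fun n hn => Finset.sum_nonneg fun l hl => ?_)
    exact mul_nonneg (mul_self_nonneg _) (hr _ (htl l hl) _ (hxn n hn))
  · rw [hB, hB']
    refine (abs_sub _ _).trans ((add_le_add ((hA p q).abs_integral_le hab hT)
      ((hA p q).abs_mesh_sum_le hab hT hN hL)).trans (le_of_eq ?_))
    ring
  · rw [hB, hB']
    refine ((hA p q).abs_integral_sub_mesh_sum_le hab hT (by positivity) (by positivity)
      hN hL).trans (le_of_eq ?_)
    ring

end Forms

/-- `C √h` is the geometric mean of the two bounds; they cross at `h = 1 / 4`, which is where the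
cases split. -/
theorem le_mul_sqrt_of_le_of_le {e C h : ℝ} (hC : 0 ≤ C) (h1 : e ≤ C / 2) (h2 : e ≤ 2 * C * h)
    (hh : 0 ≤ h) : e ≤ C * √h := by
  have hs := Real.sqrt_nonneg h
  have hsq := Real.sq_sqrt hh
  rcases le_total (1 / 2) √h with h3 | h3
  · nlinarith
  · nlinarith [mul_nonneg hC hs]

end FlowLearning

/-- `Ω = [a, b]`. The kernel `K₁` is used on `Ω × Ω`, and `K₂` on `(Ω - Ω) × (Ω - Ω)`, where
`Ω - Ω = [a - b, b - a]`, because `ψ * ρ_t` evaluates `ψ` there. `H₁`, `H₂` are the reproducing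
kernel Hilbert spaces of `K₁`, `K₂`. The hypothesis `hf` is the flow equation: `f` is
`∂ₜ ρ - Δ_ρ U'(ρ)` for the gradient flow and `∂ₜₜ ρ + Γ_W(∂ₜ ρ, ∂ₜ ρ) - Δ_ρ U'(ρ)` for the
Hamiltonian flow, and the equation of either flow is `f = Δ_ρ (V + W * ρ)`. -/
theorem mainTheorem2
    (a b T lam : ℝ) (hab : a < b) (hT : 0 < T) (hlam : 0 < lam)
    (N L : ℕ) (hN : 0 < N) (hL : 0 < L)
    (K₁ K₂ : ℝ → ℝ → ℝ) (hK₁ : IsMercerKernel K₁) (hK₂ : IsMercerKernel K₂)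
    (hK₁s : ContDiffOn ℝ 6 (Function.uncurry K₁) (Set.Icc a b ×ˢ Set.Icc a b))
    (hK₂s : ContDiffOn ℝ 6 (Function.uncurry K₂)
      (Set.Icc (a - b) (b - a) ×ˢ Set.Icc (a - b) (b - a)))
    (H₁ H₂ : Type*)
    [NormedAddCommGroup H₁] [InnerProductSpace ℝ H₁] [CompleteSpace H₁] [RKHS ℝ H₁ ℝ ℝ]
    [NormedAddCommGroup H₂] [InnerProductSpace ℝ H₂] [CompleteSpace H₂] [RKHS ℝ H₂ ℝ ℝ]
    (hH₁ : ∀ x y : ℝ, RKHS.kernel H₁ x y 1 = K₁ x y)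
    (hH₂ : ∀ x y : ℝ, RKHS.kernel H₂ x y 1 = K₂ x y)
    (ρ : ℝ → ℝ → ℝ) (hρ : IsFlowOfClass 1 2 T a b ρ) (hprob : IsProbabilityFlow T a b ρ)
    (V : H₁) (W : H₂) (f : ℝ → ℝ → ℝ)
    (hf : ∀ t ∈ Set.Icc 0 T, ∀ x ∈ Set.Icc a b, f t x = flowOperator a b ρ V W t x) :
    (∀ p : WithLp 2 (H₁ × H₂),
      IntegrableOn (fun z : ℝ × ℝ => flowOperator a b ρ p.fst p.snd z.1 z.2 ^ 2 * ρ z.1 z.2)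
        (Set.Icc 0 T ×ˢ Set.Icc a b)) ∧
    ∃ (B : WithLp 2 (H₁ × H₂) →L[ℝ] WithLp 2 (H₁ × H₂)) (pStar pNL : WithLp 2 (H₁ × H₂)),
      (∀ p q : WithLp 2 (H₁ × H₂), ⟪B p, q⟫_ℝ = flowInner T a b ρ p q) ∧
      IsUnit (B + lam • 1) ∧
      pStar = Ring.inverse (B + lam • 1) (B (WithLp.toLp 2 (V, W))) ∧
      IsUniqueMinimizer (expectedLoss T a b lam ρ V W) pStar ∧
      IsUniqueMinimizer (sampledLoss T a b lam N L ρ f) pNL ∧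
      ‖pNL - pStar‖ ≤
        (√(2 * T * supC1Norm T a b ρ / lam)
            * (kappa (Set.Icc a b) K₁ + kappa (Set.Icc (a - b) (b - a)) K₂) + 1)
          * meshConstant T a b (kappa (Set.Icc a b) K₁) (kappa (Set.Icc (a - b) (b - a)) K₂) ρ
          * lam⁻¹ * ‖(WithLp.toLp 2 (V, W) : WithLp 2 (H₁ × H₂))‖
          * √((b - a) / N + T / L) := by
  set κ₁ := kappa (Set.Icc a b) K₁
  set κ₂ := kappa (Set.Icc (a - b) (b - a)) K₂
  have hκ : 0 ≤ κ₁ + κ₂ := add_nonneg (Real.sqrt_nonneg _) (Real.sqrt_nonneg _)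
  obtain ⟨hadd, hsmul, hlip⟩ :=
    flowOperator_linear_and_lipBound hab hK₁s hK₂s hH₁ hH₂ hρ hprob
  set M := flowNorm 1 2 T a b ρ
  have hM : 0 ≤ M := flowNorm_nonneg 1 2 T a b ρ
  set D := (b - a) * timeDerivNorm T a b ρ
  have hba : 0 < b - a := by linarith
  have hD : 0 ≤ D := mul_nonneg hba.le (timeDerivNorm_nonneg T a b ρ)
  have hρlip : LipBound T a b ρ M M M := (lipBound_flowPartial hab hρ (j := 0) (by norm_num)).congr
    fun t _ x _ => (flowPartial_zero_zero t x).symm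
  have hs2 : √2 * √2 = (2 : ℝ) := Real.mul_self_sqrt (by norm_num)
  have hkk : (κ₁ + κ₂) / √2 * ((κ₁ + κ₂) / √2) = (κ₁ + κ₂) ^ 2 / 2 := by
    rw [div_mul_div_comm, hs2, sq]
  let A : WithLp 2 (H₁ × H₂) → ℝ → ℝ → ℝ := fun p => flowOperator a b ρ p.fst p.snd
  -- The product rule for `A p * A q * ρ` gives coefficients `4`, `20` and `12 + 8 D` of `M³ G G'`,
  -- where `G`, `G'` are the values for `p`, `q`; the factor `1 / 2` in `hkk` halves them.
  have hAA : ∀ p q, LipBound T a b (fun t x => A p t x * A q t x * ρ t x)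
      (2 * M ^ 3 * (κ₁ + κ₂) ^ 2 * (‖p‖ * ‖q‖)) (10 * M ^ 3 * (κ₁ + κ₂) ^ 2 * (‖p‖ * ‖q‖))
      ((6 + 4 * D) * M ^ 3 * (κ₁ + κ₂) ^ 2 * (‖p‖ * ‖q‖)) := fun p q => by
    have e : ∀ c : ℝ, c * M ^ 3 * (κ₁ + κ₂) ^ 2 * (‖p‖ * ‖q‖)
        = 2 * c * M ^ 3 * (((κ₁ + κ₂) / √2 * ‖p‖) * ((κ₁ + κ₂) / √2 * ‖q‖)) := fun c => by
      rw [mul_mul_mul_comm ((κ₁ + κ₂) / √2), hkk]; ring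
    rw [e, e, e]
    refine (((hlip p _ rfl).mul (hlip q _ rfl)).mul hρlip).mono (le_of_eq ?_) (le_of_eq ?_)
      (le_of_eq ?_) <;> ring
  obtain ⟨B, B', hB, hB', hB0, hB0', hBB, hBB'⟩ := exists_operators_of_lipBound hab.le hT.le hN hL
    (fun t ht => (hprob t ht).1) hadd hsmul (by positivity) (by positivity) hAA
  set p₀ : WithLp 2 (H₁ × H₂) := WithLp.toLp 2 (V, W)
  have hsub : ∀ p : WithLp 2 (H₁ × H₂), ∀ t ∈ Set.Icc 0 T, ∀ x ∈ Set.Icc a b,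
      A (p - p₀) t x = A p t x - flowOperator a b ρ V W t x := fun p t ht x hx => by
    have h := hadd (p - p₀) p₀ t ht x hx
    rw [sub_add_cancel] at h
    exact eq_sub_of_add_eq h.symm
  have hnorm : ∀ p : WithLp 2 (H₁ × H₂), lam * ‖p‖ ^ 2 = lam * ‖p.fst‖ ^ 2 + lam * ‖p.snd‖ ^ 2 :=
    fun p => by rw [WithLp.prod_norm_sq_eq_of_L2, mul_add]
  have hE : expectedLoss T a b lam ρ V W
      = fun p : WithLp 2 (H₁ × H₂) => ⟪B (p - p₀), p - p₀⟫_ℝ + lam * ‖p‖ ^ 2 := by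
    funext p
    rw [hnorm, ← add_assoc, hB, expectedLoss]
    congr 2
    refine integral_rectangle_congr hab.le hT.le fun t ht x hx => ?_
    rw [hsub p t ht x hx]
    simp only [A]
    ring
  -- Exactness of the data enters here: at the nodes `f` equals `A p₀`, so the sampled loss is also
  -- centred at `p₀`.
  have hS : sampledLoss T a b lam N L ρ f
      = fun p : WithLp 2 (H₁ × H₂) => ⟪B' (p - p₀), p - p₀⟫_ℝ + lam * ‖p‖ ^ 2 := by
    funext p
    rw [hnorm, ← add_assoc, hB', sampledLoss]
    congr 3
    refine Finset.sum_congr rfl fun n hn => Finset.sum_congr rfl fun l hl => ?_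
    have ht : (l : ℝ) * (T / L) ∈ Set.Icc 0 T := by
      simpa using mem_Icc_mesh hT.le (Finset.mem_Icc.1 hl).2
    have hx : a + (n : ℝ) * ((b - a) / N) ∈ Set.Icc a b :=
      mem_Icc_mesh hab.le (Finset.mem_Icc.1 hn).2
    rw [hsub p _ ht _ hx, hf _ ht _ hx]
    simp only [A]
    ring
  have hsymm : ∀ p q, ⟪B p, q⟫_ℝ = ⟪B q, p⟫_ℝ := fun p q => by
    rw [hB, hB]
    simp only [mul_comm (A p _ _)]
  have hsymm' : ∀ p q, ⟪B' p, q⟫_ℝ = ⟪B' q, p⟫_ℝ := fun p q => by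
    rw [hB', hB']
    simp only [mul_comm (A p _ _)]
  refine ⟨fun p => ?_, B, Ring.inverse (B + lam • 1) (B p₀), Ring.inverse (B' + lam • 1) (B' p₀),
    hB, isUnit_add_smul_one hB0 hlam, rfl, ?_, ?_, ?_⟩
  · refine (hAA p p).integrableOn.congr_fun (fun z _ => ?_)
      (measurableSet_Icc.prod measurableSet_Icc)
    simp only [Function.uncurry, A]
    ring
  · rw [hE]
    exact isUniqueMinimizer_ringInverse hB0 hsymm hlam p₀
  · rw [hS]
    exact isUniqueMinimizer_ringInverse hB0' hsymm' hlam p₀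
  · set C := meshConstant T a b κ₁ κ₂ ρ
    have hC : C = 2 * T * (b - a) * (κ₁ + κ₂) ^ 2 * (4 + D) * M ^ 3 := rfl
    set h := (b - a) / N + T / L with hhdef
    have hx0 : 0 ≤ (b - a) / N := div_nonneg hba.le (Nat.cast_nonneg N)
    have ht0 : 0 ≤ T / L := div_nonneg hT.le (Nat.cast_nonneg L)
    have hh : 0 ≤ h := add_nonneg hx0 ht0
    have hQ : 0 ≤ T * (b - a) * (M ^ 3 * (κ₁ + κ₂) ^ 2) := by positivity
    have hC0 : 0 ≤ C := by rw [hC]; positivity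
    -- Up to the common factor `T |Ω| M³ (κ₁ + κ₂)²`, this compares `4` with `4 + D`, and `h2`
    -- compares `10` and `6 + 4 D` with `16 + 4 D`.
    have h1 : 2 * (T * (b - a) * (2 * M ^ 3 * (κ₁ + κ₂) ^ 2)) ≤ C / 2 := by
      rw [hC]
      linarith [mul_nonneg hQ hD]
    have h2 : T * (b - a) * (10 * M ^ 3 * (κ₁ + κ₂) ^ 2 * ((b - a) / N)
        + (6 + 4 * D) * M ^ 3 * (κ₁ + κ₂) ^ 2 * (T / L)) ≤ 2 * C * h := by
      rw [hC, hhdef]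
      have e1 := mul_nonneg hQ hx0
      have e2 := mul_nonneg hQ ht0
      linarith [mul_nonneg e1 hD, mul_nonneg e2 hD]
    have hform : ∀ p q, |⟪B p, q⟫_ℝ - ⟪B' p, q⟫_ℝ| ≤ C * √h * (‖p‖ * ‖q‖) := fun p q => by
      have hpq : 0 ≤ ‖p‖ * ‖q‖ := by positivity
      refine (le_mul_sqrt_of_le_of_le (C := C * (‖p‖ * ‖q‖)) (mul_nonneg hC0 hpq) ?_ ?_ hh).trans
        (le_of_eq (by ring))
      · exact (hBB p q).trans ((mul_le_mul_of_nonneg_right h1 hpq).trans (le_of_eq (by ring)))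
      · exact (hBB' p q).trans ((mul_le_mul_of_nonneg_right h2 hpq).trans (le_of_eq (by ring)))
    refine (norm_ringInverse_sub_le hB0 hB0' hlam (mul_nonneg hC0 (Real.sqrt_nonneg _)) hform
      p₀).trans ?_
    -- The estimate is already proved with factor `1`; the square-root term only enlarges the
    -- right-hand side.
    have hP : 0 ≤ C * lam⁻¹ * ‖p₀‖ * √h := by positivity
    have hF : 0 ≤ √(2 * T * supC1Norm T a b ρ / lam) * (κ₁ + κ₂) :=
      mul_nonneg (Real.sqrt_nonneg _) hκ
    linarith [mul_nonneg hF hP]
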